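/- Let $n\ge 1$, $a_0,\dots,a_{n-1},b_0,\dots,b_{n-1}\in\mathbb C$ with $a_0+b_0z\not\equiv0$, and $$L[w]=w^{(n)}+\sum_{j=0}^{n-1}(a_j+b_jz)\,w^{(j)},\qquad Q_0(t)=(-t)^n+\sum_{j=0}^{n-1}a_j(-t)^j,\qquad Q_1(t)=\sum_{j=0}^{n-1}b_j(-t)^j ,$$ where $Q_1\not\equiv 0$. Suppose that $Q_0/Q_1$ has at $t=0$ a pole of order $p\ge 1$, and that its residue $\lambda_0=\mathrm{res}_0[Q_0/Q_1]$ is an integer. Then the kernel $$\phi_L(t)=\frac1{Q_1(t)}\exp\Big[-\int\frac{Q_0(t)}{Q_1(t)}\,dt\Big]$$ has a single-valued branch on some punctured disc about $t=0$, and for every such branch (on any punctured disc $0<|t|<r$; the constant of integration is arbitrary) the following holds. The function $$w(z)=\mathrm{res}_0\big[\phi_L(t)e^{-zt}\big]$$ is entire and solves $L[w]=0$. The point $t=0$ is an essential singularity of $\phi_L$ if and only if $p>1$, and in this case $w$ has order of growth $$\limsup_{r\to\infty}\frac{\log\log\max_{|z|=r}|w(z)|}{\log r}=1-\frac1p .$$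 If $p=1$, then $w$ is a non-trivial polynomial of degree $\lambda_0$ when $\lambda_0\ge0$, and $w$ vanishes identically when $\lambda_0<0$. -/

import Mathlib

open Filter Topology

noncomputable section

/-- The operator `L[w] = w^{(n)} + ∑_{j<n} (a_j + b_j z) w^{(j)}`, evaluated at `z`. -/
def diffOp (n : ℕ) (a b : ℕ → ℂ) (w : ℂ → ℂ) (z : ℂ) : ℂ :=
  iteratedDeriv n w z + ∑ j ∈ Finset.range n, (a j + b j * z) * iteratedDeriv j w z

/-- An entire function solving `L[w] = 0`. -/
def IsEntireSolution (n : ℕ) (a b : ℕ → ℂ) (w : ℂ → ℂ) : Prop :=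
  Differentiable ℂ w ∧ ∀ z, diffOp n a b w z = 0

/-- `Q₀(t) = (-t)^n + ∑_{j<n} a_j (-t)^j`. -/
def Qzero (n : ℕ) (a : ℕ → ℂ) (t : ℂ) : ℂ :=
  (-t) ^ n + ∑ j ∈ Finset.range n, a j * (-t) ^ j

/-- `Q₁(t) = ∑_{j<n} b_j (-t)^j`. -/
def Qone (n : ℕ) (b : ℕ → ℂ) (t : ℂ) : ℂ :=
  ∑ j ∈ Finset.range n, b j * (-t) ^ j

/-- `φ` is a single-valued branch on the open set `U` of the kernel
`φ_L(t) = (1 / Q₁(t)) exp (-∫ Q₀(t) / Q₁(t) dt)`: it is a function on `U` that near every point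
of `U` has this form for some local primitive `G` of `Q₀ / Q₁` (the constant factor of the kernel
is the constant of integration). -/
def IsLaplaceKernelOn (n : ℕ) (a b : ℕ → ℂ) (φ : ℂ → ℂ) (U : Set ℂ) : Prop :=
  ∀ t ∈ U, Qone n b t ≠ 0 ∧ ∃ G : ℂ → ℂ, ∀ᶠ s in 𝓝 t,
    HasDerivAt G (Qzero n a s / Qone n b s) s ∧ φ s = 1 / Qone n b s * Complex.exp (-G s)

/-- The residue at `c` of a function that is holomorphic on a punctured disc about `c`: the value
of `(2πi)⁻¹ ∮_{|t-c|=ρ} f(t) dt` for all small `ρ > 0`, taken here as the limit as `ρ → 0+`. -/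
def residueAt (f : ℂ → ℂ) (c : ℂ) : ℂ :=
  limUnder (𝓝[>] (0 : ℝ))
    (fun ρ : ℝ => (2 * (Real.pi : ℂ) * Complex.I)⁻¹ * ∮ t in C(c, ρ), f t)

/-- The maximum modulus `M(r, f) = max {|f z| : |z| = r}`. -/
def maxModulus (f : ℂ → ℂ) (r : ℝ) : ℝ :=
  sSup ((fun z => ‖f z‖) '' Metric.sphere (0 : ℂ) r)

/-- The order of growth `limsup_{r → ∞} log log M(r, f) / log r`. -/
def growthOrder (f : ℂ → ℂ) : EReal :=
  limsup (fun r : ℝ => ((Real.log (Real.log (maxModulus f r)) / Real.log r : ℝ) : EReal)) atTop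

end

/-! ### Contour integrals on a punctured disc -/

/-! The kernel satisfies `(Q₁φ)' = -Q₀φ`. Applying `L` under the integral multiplies the integrand
by `Q₀ + zQ₁`, which turns it into `-(Q₁ φ e^{-zt})'`, and this integrates to zero over a closed
circle (`IsLaplaceKernelOn.isEntireSolution`).

The pole forces `b₀ = 0`, hence `Q₀(0) = a₀ ≠ 0`, and with `q = p - 1` one has `Q₀/Q₁ = λ/t +
(e/t^q)'`. As `λ` is an integer, the kernel is single-valued, of the form `t^(-p-λ) g exp(-e/t^q)`
with `g` zero-free and `e(0) ≠ 0` if `q > 0` (`exists_laplaceKernel_normal_form`). Moreover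
`w^(k)(0)` is `(-1)^k` times the residue of `t^k φ`. For `q = 0` these moments vanish for `k > λ`
and not for `k = λ`, which settles the simple pole.

For `q > 0` the contour `|t| = |z|^(-1/p)` gives the upper bound for the order. For the lower bound,
the principal part of `φ` is `∑ (-1)^k w^(k)(0) t^(-k-1)`, a Borel transform of `w`. If the order
were less than `1 - 1/p`, Cauchy's estimates would bound this series by `exp(C|t|^(-τ))/|t|`, up to
a constant, with some `τ < q` (`eventually_norm_iteratedDeriv_le`, `exists_norm_le_of_moments_le`).
On the ray where `-e(0)/t^q > 0` the kernel outgrows every such bound (`exists_ray_growth`); the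
same ray rules out a pole. -/

lemma isOpen_puncturedBall (r : ℝ) : IsOpen (Metric.ball (0 : ℂ) r \ {0}) :=
  Metric.isOpen_ball.sdiff isClosed_singleton

lemma mem_puncturedBall {r : ℝ} {t : ℂ} :
    t ∈ Metric.ball (0 : ℂ) r \ {0} ↔ ‖t‖ < r ∧ t ≠ 0 := by
  simp

lemma sphere_subset_puncturedBall {r ρ : ℝ} (h0 : 0 < ρ) (h1 : ρ < r) :
    Metric.sphere (0 : ℂ) ρ ⊆ Metric.ball 0 r \ {0} := by
  intro t ht
  rw [mem_sphere_zero_iff_norm] at ht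
  exact mem_puncturedBall.2 ⟨by linarith, norm_pos_iff.1 (by linarith)⟩

lemma circleIntegral_eq_of_differentiableOn_puncturedBall {ψ : ℂ → ℂ} {r ε R : ℝ}
    (hψ : DifferentiableOn ℂ ψ (Metric.ball 0 r \ {0})) (hε : 0 < ε) (hεR : ε ≤ R) (hR : R < r) :
    (∮ t in C(0, R), ψ t) = ∮ t in C(0, ε), ψ t := by
  refine Complex.circleIntegral_eq_of_differentiable_on_annulus_off_countable hε hεR
    Set.countable_empty (hψ.continuousOn.mono ?_) ?_
  · rintro t ⟨h1, h2⟩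
    simp only [Metric.mem_closedBall, Metric.mem_ball, dist_zero_right, not_lt] at h1 h2
    exact mem_puncturedBall.2 ⟨by linarith, norm_pos_iff.1 (by linarith)⟩
  · rintro t ⟨⟨h1, h2⟩, -⟩
    simp only [Metric.mem_closedBall, Metric.mem_ball, dist_zero_right, not_le] at h1 h2
    exact hψ.differentiableAt ((isOpen_puncturedBall r).mem_nhds
      (mem_puncturedBall.2 ⟨by linarith, norm_pos_iff.1 (by linarith)⟩))

/-- The circle integral does not depend on the radius, so the limit defining the residue is that of
an eventually constant function. -/
lemma residueAt_eq_circleIntegral {ψ : ℂ → ℂ} {r ρ : ℝ}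
    (hψ : DifferentiableOn ℂ ψ (Metric.ball 0 r \ {0})) (hρ : 0 < ρ) (hρr : ρ < r) :
    residueAt ψ 0 = (2 * (Real.pi : ℂ) * Complex.I)⁻¹ * ∮ t in C(0, ρ), ψ t := by
  refine Tendsto.limUnder_eq (tendsto_const_nhds.congr' ?_)
  filter_upwards [Ioc_mem_nhdsGT hρ] with ε hε
  rw [circleIntegral_eq_of_differentiableOn_puncturedBall hψ hε.1 hε.2 hρr]

lemma circleIntegral_eq_zero_of_differentiableOn_ball {ψ : ℂ → ℂ} {r ρ : ℝ}
    (hψ : DifferentiableOn ℂ ψ (Metric.ball 0 r)) (hρ : 0 < ρ) (hρr : ρ < r) :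
    (∮ t in C(0, ρ), ψ t) = 0 := by
  refine Complex.circleIntegral_eq_zero_of_differentiable_on_off_countable hρ.le
    Set.countable_empty (hψ.continuousOn.mono (Metric.closedBall_subset_ball hρr)) ?_
  rintro t ⟨ht, -⟩
  exact hψ.differentiableAt (Metric.isOpen_ball.mem_nhds (Metric.ball_subset_ball hρr.le ht))

/-! ### Laplace transforms over a circle -/

lemma hasDerivAt_circleIntegral_mul_exp {ψ : ℂ → ℂ} {ρ : ℝ} (hρ : 0 < ρ)
    (hψ : ContinuousOn ψ (Metric.sphere 0 ρ)) (z : ℂ) :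
    HasDerivAt (fun z => ∮ t in C(0, ρ), ψ t * Complex.exp (-z * t))
      (∮ t in C(0, ρ), (-t * ψ t) * Complex.exp (-z * t)) z := by
  have hc : Continuous (fun θ : ℝ => ψ (circleMap 0 ρ θ)) :=
    hψ.comp_continuous (continuous_circleMap 0 ρ) (fun θ => circleMap_mem_sphere 0 hρ.le θ)
  have hm : Continuous (circleMap 0 ρ) := continuous_circleMap 0 ρ
  have hE : ∀ x : ℂ, Continuous (fun θ : ℝ => Complex.exp (-x * circleMap 0 ρ θ)) := fun x =>
    Complex.continuous_exp.comp (continuous_const.mul hm)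
  obtain ⟨M, hM⟩ := (isCompact_sphere (0 : ℂ) ρ).exists_bound_of_continuousOn hψ
  unfold circleIntegral
  simp only [deriv_circleMap, smul_eq_mul]
  refine (intervalIntegral.hasDerivAt_integral_of_dominated_loc_of_deriv_le (𝕜 := ℂ)
    (F := fun z θ => circleMap 0 ρ θ * Complex.I *
      (ψ (circleMap 0 ρ θ) * Complex.exp (-z * circleMap 0 ρ θ)))
    (F' := fun z θ => circleMap 0 ρ θ * Complex.I *
      (-circleMap 0 ρ θ * ψ (circleMap 0 ρ θ) * Complex.exp (-z * circleMap 0 ρ θ)))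
    (s := Metric.ball z 1) (bound := fun _ => ρ * (ρ * M * Real.exp ((‖z‖ + 1) * ρ)))
    (Metric.ball_mem_nhds z one_pos) ?_ ?_ ?_ ?_ ?_ ?_).2
  · refine Eventually.of_forall fun x => ?_
    exact Continuous.aestronglyMeasurable ((hm.mul continuous_const).mul (hc.mul (hE _)))
  · exact ((hm.mul continuous_const).mul (hc.mul (hE _))).intervalIntegrable _ _
  · exact Continuous.aestronglyMeasurable
      ((hm.mul continuous_const).mul ((hm.neg.mul hc).mul (hE _)))
  · refine Eventually.of_forall fun θ _ x hx => ?_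
    have h1 : ‖circleMap 0 ρ θ‖ = ρ := by simp [abs_of_pos hρ]
    have h2 : ‖Complex.exp (-x * circleMap 0 ρ θ)‖ ≤ Real.exp ((‖z‖ + 1) * ρ) := by
      refine (Complex.norm_exp_le_exp_norm _).trans (Real.exp_le_exp.2 ?_)
      rw [norm_mul, norm_neg, h1]
      have : ‖x‖ ≤ ‖z‖ + 1 := by
        have := norm_sub_norm_le x z
        have h3 := mem_ball_iff_norm.1 hx
        linarith
      gcongr
    have h3 := hM _ (circleMap_mem_sphere 0 hρ.le θ)
    have h4 : 0 ≤ M := (norm_nonneg _).trans h3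
    rw [norm_mul, norm_mul, norm_mul, norm_mul, norm_neg, h1, Complex.norm_I, mul_one]
    gcongr
  · exact intervalIntegrable_const
  · refine Eventually.of_forall fun θ _ x _ => ?_
    have h1 : HasDerivAt (fun x : ℂ => -x * circleMap 0 ρ θ) (-1 * circleMap 0 ρ θ) x :=
      (hasDerivAt_id x).neg.mul_const _
    exact ((h1.cexp.const_mul (ψ (circleMap 0 ρ θ))).const_mul
      (circleMap 0 ρ θ * Complex.I)).congr_deriv (by ring)

lemma iteratedDeriv_circleIntegral_mul_exp {ψ : ℂ → ℂ} {ρ : ℝ} (hρ : 0 < ρ)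
    (hψ : ContinuousOn ψ (Metric.sphere 0 ρ)) (k : ℕ) :
    iteratedDeriv k (fun z => ∮ t in C(0, ρ), ψ t * Complex.exp (-z * t)) =
      fun z => ∮ t in C(0, ρ), ((-t) ^ k * ψ t) * Complex.exp (-z * t) := by
  induction k with
  | zero => simp
  | succ k ih =>
    funext z
    rw [iteratedDeriv_succ, ih]
    have hc : ContinuousOn (fun t : ℂ => (-t) ^ k * ψ t) (Metric.sphere 0 ρ) := by fun_prop
    rw [(hasDerivAt_circleIntegral_mul_exp hρ hc z).deriv]
    exact circleIntegral.integral_congr hρ.le fun t _ => by ring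

/-- Each `z`-derivative of `e^{-zt}` produces a factor `-t`, so `L` acts under the integral through
its symbol. -/
lemma diffOp_const_mul_circleIntegral (n : ℕ) (a b : ℕ → ℂ) {φ : ℂ → ℂ} {ρ : ℝ} (hρ : 0 < ρ)
    (hφ : ContinuousOn φ (Metric.sphere 0 ρ)) (c z : ℂ) :
    diffOp n a b (fun z => c * ∮ t in C(0, ρ), φ t * Complex.exp (-z * t)) z =
      c * ∮ t in C(0, ρ), φ t * Complex.exp (-z * t) * (Qzero n a t + z * Qone n b t) := by
  have hI : ∀ g : ℂ → ℂ, Continuous g →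
      CircleIntegrable (fun t => g t * φ t * Complex.exp (-z * t)) 0 ρ := fun g hg =>
    ContinuousOn.circleIntegrable hρ.le (by fun_prop)
  have hD : ∀ k, iteratedDeriv k (fun z => c * ∮ t in C(0, ρ), φ t * Complex.exp (-z * t)) z =
      c * ∮ t in C(0, ρ), ((-t) ^ k * φ t) * Complex.exp (-z * t) := fun k => by
    rw [iteratedDeriv_const_mul_field, iteratedDeriv_circleIntegral_mul_exp hρ hφ]
  have e : ∀ t, φ t * Complex.exp (-z * t) * (Qzero n a t + z * Qone n b t) =
      (-t) ^ n * φ t * Complex.exp (-z * t) +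
        ∑ j ∈ Finset.range n, (a j + b j * z) * ((-t) ^ j * φ t * Complex.exp (-z * t)) := by
    intro t
    simp only [Qzero, Qone, Finset.mul_sum, mul_add]
    rw [add_assoc, ← Finset.sum_add_distrib]
    congr 1
    · ring
    · exact Finset.sum_congr rfl fun j _ => by ring
  simp only [e]
  rw [circleIntegral.integral_add (hI _ (by fun_prop)), circleIntegral.integral_fun_sum]
  · simp only [circleIntegral.integral_const_mul, diffOp, hD]
    rw [mul_add, Finset.mul_sum]
    congr 1
    exact Finset.sum_congr rfl fun j _ => by ring
  · intro j _
    exact ContinuousOn.circleIntegrable hρ.le (by fun_prop)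
  · exact ContinuousOn.circleIntegrable hρ.le (by fun_prop)

/-! ### The principal part of a Laurent expansion -/

/-- The difference quotient of `φ` at `t` has a removable singularity there, so its integrals over
both circles agree; `t` is inside the outer circle and outside the inner one. -/
lemma cauchy_formula_puncturedBall {φ : ℂ → ℂ} {r ε R : ℝ} {t : ℂ}
    (hφ : DifferentiableOn ℂ φ (Metric.ball 0 r \ {0}))
    (hε : 0 < ε) (hεt : ε < ‖t‖) (htR : ‖t‖ < R) (hR : R < r) :
    2 * (Real.pi : ℂ) * Complex.I * φ t =
      (∮ s in C(0, R), (s - t)⁻¹ * φ s) - ∮ s in C(0, ε), (s - t)⁻¹ * φ s := by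
  have hε' : ε < r := by linarith
  have ht : t ∈ Metric.ball (0 : ℂ) r \ {0} :=
    mem_puncturedBall.2 ⟨by linarith, norm_pos_iff.1 (by linarith)⟩
  have key := circleIntegral_eq_of_differentiableOn_puncturedBall
    ((Complex.differentiableOn_dslope ((isOpen_puncturedBall r).mem_nhds ht)).2 hφ)
    hε (hεt.trans htR).le hR
  have split : ∀ ρ, 0 < ρ → ρ < r → ρ ≠ ‖t‖ → (∮ s in C(0, ρ), dslope φ t s) =
      (∮ s in C(0, ρ), (s - t)⁻¹ * φ s) - φ t * ∮ s in C(0, ρ), (s - t)⁻¹ := by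
    intro ρ h0 h1 h2
    have hne : ∀ s ∈ Metric.sphere (0 : ℂ) ρ, s - t ≠ 0 := by
      intro s hs h
      rw [mem_sphere_zero_iff_norm, sub_eq_zero.1 h] at hs
      exact h2 hs.symm
    have hc := hφ.continuousOn.mono (sphere_subset_puncturedBall h0 h1)
    have hi : ContinuousOn (fun s : ℂ => (s - t)⁻¹) (Metric.sphere 0 ρ) :=
      ContinuousOn.inv₀ (by fun_prop) hne
    rw [← circleIntegral.integral_const_mul, ← circleIntegral.integral_sub]
    · refine circleIntegral.integral_congr h0.le fun s hs => ?_
      rw [dslope_of_ne _ (sub_ne_zero.1 (hne s hs)), slope_def_field]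
      field_simp [hne s hs]
    · exact (hi.mul hc).circleIntegrable h0.le
    · exact (continuousOn_const.mul hi).circleIntegrable h0.le
  rw [split R (by linarith) hR htR.ne', split ε hε hε' hεt.ne,
    circleIntegral.integral_sub_inv_of_mem_ball (by simpa using htR)] at key
  have h0 : (∮ s in C(0, ε), (s - t)⁻¹) = 0 := by
    refine circleIntegral_eq_zero_of_differentiableOn_ball (r := ‖t‖) ?_ hε hεt
    intro s hs
    refine DifferentiableAt.differentiableWithinAt (DifferentiableAt.inv (by fun_prop) ?_)
    intro h
    rw [mem_ball_zero_iff, sub_eq_zero.1 h] at hs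
    exact lt_irrefl _ hs
  rw [h0, mul_zero, sub_zero] at key
  linear_combination -key

/-- The principal part of `φ` at `t` is controlled by the moments `∮ s ^ k φ(s) ds`. -/
lemma norm_circleIntegral_cauchyKernel_le {φ : ℂ → ℂ} {ε B θ : ℝ} {t : ℂ}
    (hφ : ContinuousOn φ (Metric.sphere 0 ε)) (hε : 0 < ε) (hεt : ε < ‖t‖)
    (hB : 0 ≤ B) (hθ : 0 ≤ θ) (hθ1 : θ < 1)
    (hm : ∀ k : ℕ, ‖∮ s in C(0, ε), s ^ k * φ s‖ ≤ B * θ ^ k * ‖t‖ ^ k) :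
    ‖∮ s in C(0, ε), (s - t)⁻¹ * φ s‖ ≤ B / ((1 - θ) * ‖t‖) := by
  have ht : 0 < ‖t‖ := hε.trans hεt
  have ht0 : t ≠ 0 := norm_pos_iff.1 ht
  have hne : ∀ s ∈ Metric.sphere (0 : ℂ) ε, s - t ≠ 0 := by
    intro s hs h
    rw [mem_sphere_zero_iff_norm, sub_eq_zero.1 h] at hs
    exact hεt.ne' hs
  have hi : ContinuousOn (fun s : ℂ => (s - t)⁻¹) (Metric.sphere 0 ε) :=
    ContinuousOn.inv₀ (by fun_prop) hne
  obtain ⟨M, hM⟩ := (isCompact_sphere (0 : ℂ) ε).exists_bound_of_continuousOn (hi.mul hφ)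
  -- Finite geometric expansion of `1/(s - t)` in powers of `s/t`; the remainder dies as `N → ∞`
  -- because `ε < ‖t‖`.
  have expand : ∀ N : ℕ, (∮ s in C(0, ε), (s - t)⁻¹ * φ s) =
      (∮ s in C(0, ε), (s / t) ^ N * ((s - t)⁻¹ * φ s)) -
        ∑ k ∈ Finset.range N, (t ^ (k + 1))⁻¹ * ∮ s in C(0, ε), s ^ k * φ s := by
    intro N
    induction N with
    | zero => simp
    | succ N ih =>
      rw [ih, Finset.sum_range_succ, ← circleIntegral.integral_const_mul, ← sub_sub,
        sub_right_comm, ← circleIntegral.integral_sub]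
      · congr 1
        refine circleIntegral.integral_congr hε.le fun s hs => ?_
        have := hne s hs
        rw [div_pow, div_pow, pow_succ, pow_succ]
        field_simp
        ring
      · exact ContinuousOn.circleIntegrable hε.le (by fun_prop)
      · exact ContinuousOn.circleIntegrable hε.le (by fun_prop)
  have bound : ∀ N : ℕ, ‖∮ s in C(0, ε), (s - t)⁻¹ * φ s‖ ≤
      2 * Real.pi * ε * ((ε / ‖t‖) ^ N * M) + B / ((1 - θ) * ‖t‖) := by
    intro N
    rw [expand N]
    refine (norm_sub_le _ _).trans (add_le_add ?_ ?_)
    · refine circleIntegral.norm_integral_le_of_norm_le_const hε.le fun s hs => ?_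
      rw [norm_mul, norm_pow, norm_div, mem_sphere_zero_iff_norm.1 hs]
      exact mul_le_mul_of_nonneg_left (hM s hs) (by positivity)
    · calc ‖∑ k ∈ Finset.range N, (t ^ (k + 1))⁻¹ * ∮ s in C(0, ε), s ^ k * φ s‖
          ≤ ∑ k ∈ Finset.range N, B / ‖t‖ * θ ^ k := by
            refine norm_sum_le_of_le _ fun k _ => ?_
            rw [norm_mul, norm_inv, norm_pow]
            calc (‖t‖ ^ (k + 1))⁻¹ * ‖∮ s in C(0, ε), s ^ k * φ s‖
                ≤ (‖t‖ ^ (k + 1))⁻¹ * (B * θ ^ k * ‖t‖ ^ k) := by gcongr; exact hm k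
              _ = B / ‖t‖ * θ ^ k := by field_simp; ring
        _ = B / ‖t‖ * ∑ k ∈ Finset.range N, θ ^ k := by rw [Finset.mul_sum]
        _ ≤ B / ‖t‖ * (1 - θ)⁻¹ := by
            gcongr
            rw [← tsum_geometric_of_lt_one hθ hθ1]
            exact (summable_geometric_of_lt_one hθ hθ1).sum_le_tsum _ fun _ _ => by positivity
        _ = B / ((1 - θ) * ‖t‖) := by
            have : 1 - θ ≠ 0 := by linarith
            field_simp
  have lim : Tendsto (fun N : ℕ => 2 * Real.pi * ε * ((ε / ‖t‖) ^ N * M) +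
      B / ((1 - θ) * ‖t‖)) atTop (𝓝 (2 * Real.pi * ε * (0 * M) + B / ((1 - θ) * ‖t‖))) :=
    (((tendsto_pow_atTop_nhds_zero_of_lt_one (by positivity)
      ((div_lt_one ht).2 hεt)).mul_const M).const_mul _).add_const _
  have := ge_of_tendsto' lim bound
  simpa using this

/-- A function holomorphic in a punctured disc is bounded by its moments: the regular part of its
Laurent expansion is bounded, and the principal part is controlled by the moments. -/
lemma exists_norm_le_of_moments_le {φ : ℂ → ℂ} {r R : ℝ}
    (hφ : DifferentiableOn ℂ φ (Metric.ball 0 r \ {0})) (hR0 : 0 < R) (hR : R < r) :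
    ∃ A : ℝ, 0 ≤ A ∧ ∀ t : ℂ, t ≠ 0 → ‖t‖ ≤ R / 2 → ∀ B θ : ℝ, 0 ≤ B → 0 ≤ θ → θ < 1 →
      (∀ k : ℕ, ‖∮ s in C(0, R), s ^ k * φ s‖ ≤ B * θ ^ k * ‖t‖ ^ k) →
      ‖φ t‖ ≤ A + B / ((1 - θ) * ‖t‖) := by
  obtain ⟨M, hM⟩ := (isCompact_sphere (0 : ℂ) R).exists_bound_of_continuousOn
    (hφ.continuousOn.mono (sphere_subset_puncturedBall hR0 hR))
  have hM0 : 0 ≤ M := (norm_nonneg _).trans (hM (R : ℂ) (by simp [abs_of_pos hR0]))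
  refine ⟨2 * Real.pi * R * ((R / 2)⁻¹ * M), by positivity, ?_⟩
  intro t ht htR B θ hB hθ hθ1 hm
  have htp : 0 < ‖t‖ := norm_pos_iff.2 ht
  -- The inner radius may be anything below `‖t‖`, since the moments do not depend on it. The outer
  -- circle stays fixed, which makes `A` uniform in `t`.
  have hcf := cauchy_formula_puncturedBall (ε := ‖t‖ / 2) hφ (by linarith) (by linarith)
    (show ‖t‖ < R by linarith) hR
  have h1 : ‖∮ s in C(0, R), (s - t)⁻¹ * φ s‖ ≤ 2 * Real.pi * R * ((R / 2)⁻¹ * M) := by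
    refine circleIntegral.norm_integral_le_of_norm_le_const hR0.le fun s hs => ?_
    rw [norm_mul, norm_inv]
    have h2 : R / 2 ≤ ‖s - t‖ := by
      have := norm_sub_norm_le s t
      rw [mem_sphere_zero_iff_norm.1 hs] at this
      linarith
    have := hM s hs
    gcongr
  have h2 : ‖∮ s in C(0, ‖t‖ / 2), (s - t)⁻¹ * φ s‖ ≤ B / ((1 - θ) * ‖t‖) := by
    refine norm_circleIntegral_cauchyKernel_le
      (hφ.continuousOn.mono (sphere_subset_puncturedBall (by linarith) (by linarith)))
      (by linarith) (by linarith) hB hθ hθ1 fun k => ?_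
    rw [← circleIntegral_eq_of_differentiableOn_puncturedBall (R := R) _ (by linarith)
      (by linarith) hR]
    · exact hm k
    · exact DifferentiableOn.mul (by fun_prop) hφ
  have h3 : ‖2 * (Real.pi : ℂ) * Complex.I * φ t‖ = 2 * Real.pi * ‖φ t‖ := by
    simp [abs_of_pos Real.pi_pos]
  have h4 := norm_sub_le (∮ s in C(0, R), (s - t)⁻¹ * φ s)
    (∮ s in C(0, ‖t‖ / 2), (s - t)⁻¹ * φ s)
  rw [← hcf, h3] at h4
  have h5 : 1 ≤ 2 * Real.pi := by linarith [Real.pi_gt_three]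
  nlinarith [norm_nonneg (φ t)]

/-! ### Normal form of the kernel at a pole -/

/-- A holomorphic `h` on a disc is `μ t ^ q + t e' - q e` with `e` holomorphic; equivalently,
`h / t ^ (q + 1)` is `μ / t` plus the derivative of `e / t ^ q`. -/
lemma exists_eq_mul_pow_add_euler (q : ℕ) {h : ℂ → ℂ} {r : ℝ} (hr : 0 < r)
    (hh : DifferentiableOn ℂ h (Metric.ball 0 r)) :
    ∃ (μ : ℂ) (e : ℂ → ℂ), DifferentiableOn ℂ e (Metric.ball 0 r) ∧
      ∀ t ∈ Metric.ball (0 : ℂ) r, h t = μ * t ^ q + t * deriv e t - q * e t := by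
  have hnhds : Metric.ball (0 : ℂ) r ∈ 𝓝 0 := Metric.ball_mem_nhds 0 hr
  induction q generalizing h with
  | zero =>
    obtain ⟨K, hK⟩ := ((Complex.differentiableOn_dslope hnhds).2 hh).isExactOn_ball
    refine ⟨h 0, K, fun t ht => (hK t ht).differentiableAt.differentiableWithinAt, ?_⟩
    intro t ht
    have := sub_smul_dslope h 0 t
    rw [(hK t ht).deriv]
    simp only [sub_zero, smul_eq_mul] at this
    rw [this]
    simp
  | succ q ih =>
    obtain ⟨μ, e, he, heq⟩ := ih ((Complex.differentiableOn_dslope hnhds).2 hh)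
    -- The constant term is chosen so that `-(q + 1) e(0) = h(0)`; the rest is the previous case
    -- applied to `(h - h(0))/t`.
    refine ⟨μ, fun t => -h 0 / (q + 1) + t * e t, by fun_prop, ?_⟩
    intro t ht
    have hd := (he.differentiableAt (Metric.isOpen_ball.mem_nhds ht)).hasDerivAt
    have hd' : HasDerivAt (fun t => -h 0 / (q + 1) + t * e t) (1 * e t + t * deriv e t) t :=
      ((hasDerivAt_id t).mul hd).const_add _
    have := sub_smul_dslope h 0 t
    rw [hd'.deriv]
    rw [heq t ht, sub_zero, smul_eq_mul] at this
    have hq : (q : ℂ) + 1 ≠ 0 := by exact_mod_cast q.succ_ne_zero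
    push_cast
    field_simp
    linear_combination -this

/-- The exponential maps the half-plane `Re u < log r` onto the punctured disc, and the half-plane
is convex, hence connected. -/
lemma exists_eq_const_of_hasDerivAt_zero {f : ℂ → ℂ} {r : ℝ} (hr : 0 < r)
    (hf : ∀ t ∈ Metric.ball (0 : ℂ) r \ {0}, HasDerivAt f 0 t) :
    ∃ C, ∀ t ∈ Metric.ball (0 : ℂ) r \ {0}, f t = C := by
  have hmem : ∀ u ∈ {u : ℂ | u.re < Real.log r}, Complex.exp u ∈ Metric.ball (0 : ℂ) r \ {0} := by
    intro u hu
    refine mem_puncturedBall.2 ⟨?_, Complex.exp_ne_zero u⟩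
    rw [Complex.norm_exp]
    exact (Real.lt_log_iff_exp_lt hr).1 hu
  have hd : ∀ u ∈ {u : ℂ | u.re < Real.log r}, HasDerivAt (fun u => f (Complex.exp u)) 0 u := by
    intro u hu
    have := (hf _ (hmem u hu)).comp u (Complex.hasDerivAt_exp u)
    rw [zero_mul] at this
    exact this
  obtain ⟨C, hC⟩ := (isOpen_lt Complex.continuous_re continuous_const).exists_is_const_of_deriv_eq_zero
    (convex_halfSpace_re_lt (Real.log r)).isPreconnected
    (fun u hu => (hd u hu).differentiableAt.differentiableWithinAt) (fun u hu => (hd u hu).deriv)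
  refine ⟨C, fun t ht => ?_⟩
  obtain ⟨h1, h2⟩ := mem_puncturedBall.1 ht
  rw [← hC (Complex.log t), Complex.exp_log h2]
  simpa [Complex.log_re] using Real.log_lt_log (norm_pos_iff.2 h2) h1

lemma differentiable_Qzero (n : ℕ) (a : ℕ → ℂ) : Differentiable ℂ (Qzero n a) := by
  unfold Qzero; fun_prop

lemma differentiable_Qone (n : ℕ) (b : ℕ → ℂ) : Differentiable ℂ (Qone n b) := by
  unfold Qone; fun_prop

/-- At a pole of order `p` of `Q₀ / Q₁` at the origin, `Q₀` does not vanish and `Q₁` has a zero of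
order exactly `p`. -/
lemma exists_Qone_eq_pow_mul (n : ℕ) (a b : ℕ → ℂ) (hab : a 0 ≠ 0 ∨ b 0 ≠ 0)
    (p : ℕ) (hp : 1 ≤ p)
    (hpole : meromorphicOrderAt (fun t : ℂ => Qzero n a t / Qone n b t) 0 =
      ((-(p : ℤ) : ℤ) : WithTop ℤ)) :
    ∃ r : ℝ, 0 < r ∧ ∃ h : ℂ → ℂ, DifferentiableOn ℂ h (Metric.ball 0 r) ∧
      (∀ t ∈ Metric.ball (0 : ℂ) r, h t ≠ 0 ∧ Qzero n a t ≠ 0) ∧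
      ∀ t ∈ Metric.ball (0 : ℂ) r \ {0}, Qone n b t = t ^ p * Qzero n a t / h t := by
  have hQ0 := differentiable_Qzero n a
  have hQ1 := differentiable_Qone n b
  have hm : MeromorphicAt (fun t : ℂ => Qzero n a t / Qone n b t) 0 :=
    (hQ0.analyticAt 0).meromorphicAt.div (hQ1.analyticAt 0).meromorphicAt
  obtain ⟨h, hh, hh0, heq⟩ := (meromorphicOrderAt_eq_int_iff hm).1 hpole
  have hev : ∀ᶠ t in 𝓝 (0 : ℂ), t ≠ 0 → Qone n b t ≠ 0 ∧ Qone n b t = t ^ p * Qzero n a t / h t := by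
    filter_upwards [eventually_nhdsWithin_iff.1 heq, hh.continuousAt.eventually_ne hh0]
      with t h1 h2 h3
    have h4 := h1 h3
    simp only [sub_zero, zpow_neg, zpow_natCast, smul_eq_mul] at h4
    have h5 : t ^ p ≠ 0 := pow_ne_zero _ h3
    have h6 : Qone n b t ≠ 0 := by
      intro h0
      rw [h0, div_zero] at h4
      exact mul_ne_zero (inv_ne_zero h5) h2 h4.symm
    refine ⟨h6, ?_⟩
    rw [div_eq_iff h6] at h4
    rw [h4]
    field_simp
  -- The factorisation holds only off the origin, so the value at `0` is reached as a limit.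
  have hQ10 : Qone n b 0 = 0 := by
    have h1 : Tendsto (Qone n b) (𝓝[≠] 0) (𝓝 (Qone n b 0)) :=
      (hQ1.continuous.tendsto 0).mono_left nhdsWithin_le_nhds
    have h2 : Tendsto (fun t => t ^ p * Qzero n a t / h t) (𝓝[≠] 0)
        (𝓝 (0 ^ p * Qzero n a 0 / h 0)) :=
      ((((continuous_pow p).tendsto 0).mul (hQ0.continuous.tendsto 0)).div
        hh.continuousAt hh0).mono_left nhdsWithin_le_nhds
    have hx : ∀ᶠ t in 𝓝[≠] (0 : ℂ), Qone n b t = t ^ p * Qzero n a t / h t :=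
      eventually_nhdsWithin_iff.2 (hev.mono fun t ht h => (ht h).2)
    have h3 := tendsto_nhds_unique (h1.congr' hx) h2
    simpa [Nat.one_le_iff_ne_zero.1 hp] using h3
  have hn : n ≠ 0 := by
    rintro rfl
    have hx : ∀ᶠ t in 𝓝[≠] (0 : ℂ), Qone 0 b t ≠ 0 :=
      eventually_nhdsWithin_iff.2 (hev.mono fun t ht h => (ht h).1)
    obtain ⟨t, ht⟩ := hx.exists
    exact ht (by simp [Qone])
  obtain ⟨m, rfl⟩ := Nat.exists_eq_succ_of_ne_zero hn
  -- For `n ≥ 1` the values at the origin are `Q₁(0) = b₀` and `Q₀(0) = a₀`; the first vanishes, so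
  -- `hab` makes the second non-zero.
  have hb : b 0 = 0 := by simpa [Qone, Finset.sum_range_succ'] using hQ10
  have hQ00 : Qzero (m + 1) a 0 ≠ 0 := by
    simpa [Qzero, Finset.sum_range_succ', hb] using hab
  obtain ⟨r, hr, hball⟩ := Metric.eventually_nhds_iff_ball.1
    (hev.and (hh.eventually_analyticAt.and ((hh.continuousAt.eventually_ne hh0).and
      (hQ0.continuous.continuousAt.eventually_ne hQ00))))
  exact ⟨r, hr, h, fun t ht => (hball t ht).2.1.differentiableAt.differentiableWithinAt,
    fun t ht => (hball t ht).2.2, fun t ht => ((hball t ht.1).1 ht.2).2⟩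

/-- The kernel is, up to a constant factor, `t ^ (-p - λ) g(t) exp (-e(t) / t ^ (p - 1))` with
`g` zero-free; here `p = q + 1`. -/
lemma exists_laplaceKernel_normal_form (n : ℕ) (a b : ℕ → ℂ) (hab : a 0 ≠ 0 ∨ b 0 ≠ 0) (q : ℕ)
    (hpole : meromorphicOrderAt (fun t : ℂ => Qzero n a t / Qone n b t) 0 =
      ((-((q + 1 : ℕ) : ℤ) : ℤ) : WithTop ℤ))
    (lam : ℤ) (hres : residueAt (fun t : ℂ => Qzero n a t / Qone n b t) 0 = (lam : ℂ)) :
    ∃ r₀ : ℝ, 0 < r₀ ∧ ∃ g e : ℂ → ℂ, DifferentiableOn ℂ g (Metric.ball 0 r₀) ∧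
      (∀ t ∈ Metric.ball (0 : ℂ) r₀, g t ≠ 0) ∧ DifferentiableOn ℂ e (Metric.ball 0 r₀) ∧
      (q ≠ 0 → e 0 ≠ 0) ∧
      (∃ φ, IsLaplaceKernelOn n a b φ (Metric.ball 0 r₀ \ {0})) ∧
      ∀ r : ℝ, 0 < r → r ≤ r₀ → ∀ φ, IsLaplaceKernelOn n a b φ (Metric.ball 0 r \ {0}) →
        ∃ C : ℂ, C ≠ 0 ∧ ∀ t ∈ Metric.ball (0 : ℂ) r \ {0},
          φ t = t ^ (-((q : ℤ) + 1) - lam) * (C * g t) * Complex.exp (-(e t / t ^ q)) := by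
  obtain ⟨r₀, hr₀, h, hh, hne, hQ⟩ := exists_Qone_eq_pow_mul n a b hab (q + 1) (by omega) hpole
  obtain ⟨μ, e, he, heq⟩ := exists_eq_mul_pow_add_euler q hr₀ hh
  have hQ1 : ∀ t ∈ Metric.ball (0 : ℂ) r₀ \ {0}, Qone n b t ≠ 0 := by
    intro t ht
    rw [hQ t ht]
    exact div_ne_zero (mul_ne_zero (pow_ne_zero _ ht.2) (hne t ht.1).2) (hne t ht.1).1
  have hE : ∀ t ∈ Metric.ball (0 : ℂ) r₀ \ {0},
      HasDerivAt (fun s => e s / s ^ q) (Qzero n a t / Qone n b t - μ / t) t := by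
    intro t ht
    have ht0 : t ≠ 0 := ht.2
    have hd := (he.differentiableAt (Metric.isOpen_ball.mem_nhds ht.1)).hasDerivAt
    refine (hd.div (hasDerivAt_pow q t) (pow_ne_zero _ ht0)).congr_deriv ?_
    have hF : Qzero n a t / Qone n b t = h t / t ^ (q + 1) := by
      rw [hQ t ht]
      have := (hne t ht.1).2
      have := (hne t ht.1).1
      field_simp
    have hpow : (q : ℂ) * t ^ (q - 1) = q * t ^ q / t := by
      cases q with
      | zero => simp
      | succ q => field_simp; simp [pow_succ]
    rw [hF, heq t ht.1, hpow]
    field_simp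
    ring
  have hFd : DifferentiableOn ℂ (fun t => Qzero n a t / Qone n b t)
      (Metric.ball (0 : ℂ) r₀ \ {0}) :=
    (differentiable_Qzero n a).differentiableOn.div (differentiable_Qone n b).differentiableOn hQ1
  -- Integrating over a circle kills the exact part `(e/t^q)'` and leaves the residue.
  have hμ : μ = lam := by
    have hρ : 0 < r₀ / 2 := by linarith
    have hρr : r₀ / 2 < r₀ := by linarith
    have hsub := sphere_subset_puncturedBall hρ hρr
    rw [residueAt_eq_circleIntegral hFd hρ hρr] at hres
    have h0 := circleIntegral.integral_eq_zero_of_hasDerivWithinAt hρ.le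
      fun t ht => (hE t (hsub ht)).hasDerivWithinAt
    have hinv : ContinuousOn (fun t : ℂ => t⁻¹) (Metric.sphere 0 (r₀ / 2)) :=
      ContinuousOn.inv₀ (by fun_prop) fun t ht => (hsub ht).2
    simp only [div_eq_mul_inv μ] at h0
    rw [circleIntegral.integral_sub, circleIntegral.integral_const_mul, sub_eq_zero] at h0
    · have h1 := circleIntegral.integral_sub_center_inv (0 : ℂ) hρ.ne'
      simp only [sub_zero] at h1
      rw [h0, h1] at hres
      rw [← hres]
      have := Complex.two_pi_I_ne_zero
      field_simp
    · exact (hFd.continuousOn.mono hsub).circleIntegrable hρ.le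
    · exact (continuousOn_const.mul hinv).circleIntegrable hρ.le
  subst hμ
  have hinvQ : ∀ t ∈ Metric.ball (0 : ℂ) r₀ \ {0},
      (Qone n b t)⁻¹ = h t / Qzero n a t * (t ^ (q + 1))⁻¹ := by
    intro t ht
    rw [hQ t ht]
    have := (hne t ht.1).2
    have := (hne t ht.1).1
    have ht0 : t ≠ 0 := ht.2
    field_simp
  refine ⟨r₀, hr₀, fun t => h t / Qzero n a t, e,
    hh.div (differentiable_Qzero n a).differentiableOn fun t ht => (hne t ht).2,
    fun t ht => div_ne_zero (hne t ht).1 (hne t ht).2, he, ?_, ?_, ?_⟩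
  · intro hq h0
    have := heq 0 (Metric.mem_ball_self hr₀)
    rw [h0] at this
    exact (hne 0 (Metric.mem_ball_self hr₀)).1 (by simpa [hq] using this)
  · refine ⟨fun t => 1 / Qone n b t * (t ^ (-lam) * Complex.exp (-(e t / t ^ q))), ?_⟩
    intro t ht
    have ht0 : t ≠ 0 := ht.2
    -- Since `s/t` is near `1`, `log (s/t) + log t` is a branch of the logarithm around `t`; its
    -- choice is invisible after exponentiation because `lam` is an integer.
    refine ⟨hQ1 t ht, fun s => e s / s ^ q + lam * (Complex.log (s / t) + Complex.log t), ?_⟩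
    have hslit : ∀ᶠ s in 𝓝 t, s / t ∈ Complex.slitPlane := by
      have : ContinuousAt (fun s : ℂ => s / t) t := by fun_prop
      refine this.eventually_mem (Complex.isOpen_slitPlane.mem_nhds ?_)
      rw [div_self ht0]
      exact Complex.one_mem_slitPlane
    filter_upwards [hslit, (isOpen_puncturedBall r₀).mem_nhds ht] with s hs hsU
    have hs0 : s ≠ 0 := hsU.2
    constructor
    · have h1 := (((hasDerivAt_id s).div_const t).clog hs).add_const (Complex.log t)
      refine ((hE s hsU).add (h1.const_mul (lam : ℂ))).congr_deriv ?_
      simp only [id]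
      field_simp
      ring
    · congr 1
      rw [neg_add, Complex.exp_add, mul_comm]
      congr 1
      have h1 : -((lam : ℂ) * (Complex.log (s / t) + Complex.log t)) =
          ((-lam : ℤ) : ℂ) * (Complex.log (s / t) + Complex.log t) := by push_cast; ring
      rw [h1, Complex.exp_int_mul, Complex.exp_add, Complex.exp_log (div_ne_zero hs0 ht0),
        Complex.exp_log ht0, div_mul_cancel₀ _ ht0]
  · intro r hr hrr φ hφ
    have hsub : Metric.ball (0 : ℂ) r \ {0} ⊆ Metric.ball 0 r₀ \ {0} :=
      Set.sdiff_subset_sdiff_left (Metric.ball_subset_ball hrr)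
    -- Dividing an arbitrary branch by the explicit one gives a function with zero derivative.
    obtain ⟨C, hC⟩ := exists_eq_const_of_hasDerivAt_zero hr
      (f := fun t => φ t * Qone n b t * t ^ lam * Complex.exp (e t / t ^ q)) (fun t ht => by
        have ht0 : t ≠ 0 := ht.2
        obtain ⟨-, G, hG⟩ := hφ t ht
        have h1 : (fun t => φ t * Qone n b t * t ^ lam * Complex.exp (e t / t ^ q)) =ᶠ[𝓝 t]
            fun t => Complex.exp (-G t) * t ^ lam * Complex.exp (e t / t ^ q) := by
          filter_upwards [hG, (isOpen_puncturedBall r).mem_nhds ht] with s hs hsU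
          have := hQ1 s (hsub hsU)
          rw [hs.2]
          field_simp
        refine HasDerivAt.congr_of_eventuallyEq ?_ h1
        have h2 := hG.self_of_nhds.1
        refine ((h2.neg.cexp.mul (hasDerivAt_zpow lam t (Or.inl ht0))).mul
          (hE t (hsub ht)).cexp).congr_deriv ?_
        rw [zpow_sub_one₀ ht0]
        simp only [Pi.mul_apply, Pi.neg_apply]
        field_simp
        ring)
    refine ⟨C, ?_, ?_⟩
    · obtain ⟨t, ht⟩ : ((Metric.ball (0 : ℂ) r) \ {0}).Nonempty :=
        ⟨(r / 2 : ℝ), mem_puncturedBall.2 ⟨by simp [abs_of_pos hr, hr], by simp [hr.ne']⟩⟩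
      obtain ⟨h1, G, hG⟩ := hφ t ht
      rw [← hC t ht, hG.self_of_nhds.2]
      have ht0 : t ≠ 0 := ht.2
      have := zpow_ne_zero lam ht0
      simp [h1, this, Complex.exp_ne_zero]
    · intro t ht
      have ht0 : t ≠ 0 := ht.2
      have h1 : φ t = C * (Qone n b t)⁻¹ * t ^ (-lam) * Complex.exp (-(e t / t ^ q)) := by
        rw [← hC t ht, zpow_neg, Complex.exp_neg]
        have := hQ1 t (hsub ht)
        have := zpow_ne_zero lam ht0
        have := Complex.exp_ne_zero (e t / t ^ q)
        field_simp
      rw [h1, hinvQ t (hsub ht), sub_eq_add_neg, zpow_add₀ ht0, zpow_neg t ((q : ℤ) + 1)]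
      norm_cast
      ring

/-- Locally the product is `exp (-G)`. This first-order equation is what makes the transformed
integrand exact. -/
lemma IsLaplaceKernelOn.hasDerivAt_Qone_mul {n : ℕ} {a b : ℕ → ℂ} {φ : ℂ → ℂ} {U : Set ℂ}
    (hφ : IsLaplaceKernelOn n a b φ U) (hU : IsOpen U) {t : ℂ} (ht : t ∈ U) :
    HasDerivAt (fun s => Qone n b s * φ s) (-Qzero n a t * φ t) t := by
  obtain ⟨h1, G, hG⟩ := hφ t ht
  have h2 : (fun s => Qone n b s * φ s) =ᶠ[𝓝 t] fun s => Complex.exp (-G s) := by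
    filter_upwards [hG, hU.mem_nhds ht] with s hs hsU
    have := (hφ s hsU).1
    rw [hs.2]
    field_simp
  refine HasDerivAt.congr_of_eventuallyEq ?_ h2
  refine hG.self_of_nhds.1.neg.cexp.congr_deriv ?_
  rw [hG.self_of_nhds.2, Pi.neg_apply]
  field_simp

lemma IsLaplaceKernelOn.differentiableOn {n : ℕ} {a b : ℕ → ℂ} {φ : ℂ → ℂ} {U : Set ℂ}
    (hφ : IsLaplaceKernelOn n a b φ U) (hU : IsOpen U) : DifferentiableOn ℂ φ U := by
  have h1 : DifferentiableOn ℂ (fun s => Qone n b s * φ s) U := fun t ht =>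
    (hφ.hasDerivAt_Qone_mul hU ht).differentiableAt.differentiableWithinAt
  refine (h1.div (differentiable_Qone n b).differentiableOn fun t ht => (hφ t ht).1).congr ?_
  intro t ht
  exact (mul_div_cancel_left₀ _ (hφ t ht).1).symm

/-- Integrals of `φ(t) exp (-z t)` over a closed circle solve the equation. -/
lemma IsLaplaceKernelOn.isEntireSolution {n : ℕ} {a b : ℕ → ℂ} {φ : ℂ → ℂ} {r ρ : ℝ}
    (hφ : IsLaplaceKernelOn n a b φ (Metric.ball 0 r \ {0})) (hρ : 0 < ρ) (hρr : ρ < r) (c : ℂ) :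
    IsEntireSolution n a b (fun z => c * ∮ t in C(0, ρ), φ t * Complex.exp (-z * t)) := by
  have hU := isOpen_puncturedBall r
  have hsub := sphere_subset_puncturedBall hρ hρr
  have hc := (hφ.differentiableOn hU).continuousOn.mono hsub
  refine ⟨fun z => ((hasDerivAt_circleIntegral_mul_exp hρ hc z).const_mul c).differentiableAt,
    fun z => ?_⟩
  rw [diffOp_const_mul_circleIntegral n a b hρ hc]
  refine mul_eq_zero_of_right _ ?_
  refine circleIntegral.integral_eq_zero_of_hasDerivWithinAt hρ.le
    (f := fun t => -(Qone n b t * φ t * Complex.exp (-z * t))) fun t ht => ?_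
  have h1 : HasDerivAt (fun t : ℂ => -z * t) (-z * 1) t := (hasDerivAt_id t).const_mul (-z)
  refine (((hφ.hasDerivAt_Qone_mul hU (hsub ht)).mul h1.cexp).neg.congr_deriv ?_).hasDerivWithinAt
  ring

/-! ### Simple poles -/

lemma iteratedDeriv_zero_const_mul_circleIntegral_mul_exp {φ : ℂ → ℂ} {ρ : ℝ} (hρ : 0 < ρ)
    (hφ : ContinuousOn φ (Metric.sphere 0 ρ)) (c : ℂ) (k : ℕ) :
    iteratedDeriv k (fun z => c * ∮ t in C(0, ρ), φ t * Complex.exp (-z * t)) 0 =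
      c * (-1) ^ k * ∮ t in C(0, ρ), t ^ k * φ t := by
  rw [iteratedDeriv_const_mul_field, iteratedDeriv_circleIntegral_mul_exp hρ hφ, mul_assoc]
  congr 1
  rw [← circleIntegral.integral_const_mul]
  refine circleIntegral.integral_congr hρ.le fun t _ => ?_
  simp only [neg_zero, zero_mul, Complex.exp_zero, mul_one]
  rw [neg_pow]
  ring

/-- The Taylor series at `0` is a finite sum with non-zero coefficient at `N`. -/
lemma exists_polynomial_eq_of_iteratedDeriv_eq_zero {w : ℂ → ℂ} (hw : Differentiable ℂ w) {N : ℕ}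
    (hN : iteratedDeriv N w 0 ≠ 0) (hgt : ∀ k, N < k → iteratedDeriv k w 0 = 0) :
    ∃ P : Polynomial ℂ, P ≠ 0 ∧ P.natDegree = N ∧ ∀ z, w z = P.eval z := by
  set P : Polynomial ℂ := ∑ k ∈ Finset.range (N + 1),
    Polynomial.C ((k.factorial : ℂ)⁻¹ * iteratedDeriv k w 0) * Polynomial.X ^ k with hP
  have hcoeff : P.coeff N ≠ 0 := by
    have : P.coeff N = (N.factorial : ℂ)⁻¹ * iteratedDeriv N w 0 := by
      rw [hP, Polynomial.finsetSum_coeff]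
      simp only [Polynomial.coeff_C_mul, Polynomial.coeff_X_pow]
      simp
    rw [this]
    exact mul_ne_zero (inv_ne_zero (by exact_mod_cast N.factorial_ne_zero)) hN
  refine ⟨P, fun h => hcoeff (by simp [h]), le_antisymm ?_ (Polynomial.le_natDegree_of_ne_zero hcoeff),
    fun z => ?_⟩
  · refine Polynomial.natDegree_sum_le_of_forall_le _ _ fun k hk => ?_
    exact (Polynomial.natDegree_C_mul_X_pow_le _ _).trans (by simpa [Nat.lt_succ_iff] using hk)
  · rw [← Complex.taylorSeries_eq_of_entire hw 0 z, hP, Polynomial.eval_finsetSum,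
      tsum_eq_sum (s := Finset.range (N + 1))]
    · refine Finset.sum_congr rfl fun k _ => ?_
      simp
      ring
    · intro k hk
      rw [hgt k (by simpa using hk)]
      simp

/-- Moments of `t ^ (-1 - λ) g(t)`. -/
lemma circleIntegral_pow_mul_zpow_mul {g : ℂ → ℂ} {r ρ : ℝ}
    (hg : DifferentiableOn ℂ g (Metric.ball 0 r)) (hρ : 0 < ρ) (hρr : ρ < r) (lam : ℤ) (k : ℕ) :
    (lam < k → (∮ t in C(0, ρ), t ^ k * (t ^ (-1 - lam) * g t)) = 0) ∧
    ((k : ℤ) = lam → (∮ t in C(0, ρ), t ^ k * (t ^ (-1 - lam) * g t)) =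
      2 * Real.pi * Complex.I * g 0) := by
  have hne : ∀ t ∈ Metric.sphere (0 : ℂ) ρ, t ≠ 0 := fun t ht =>
    (sphere_subset_puncturedBall hρ hρr ht).2
  constructor
  · intro hlt
    obtain ⟨m, hm⟩ := Int.eq_ofNat_of_zero_le (show 0 ≤ (k : ℤ) + (-1 - lam) by omega)
    rw [circleIntegral.integral_congr (g := fun t => t ^ m * g t) hρ.le]
    · exact circleIntegral_eq_zero_of_differentiableOn_ball
        (DifferentiableOn.mul (by fun_prop) hg) hρ hρr
    · intro t ht
      simp only
      rw [← mul_assoc, ← zpow_natCast, ← zpow_add₀ (hne t ht), hm, zpow_natCast]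
  · intro heq
    rw [circleIntegral.integral_congr (g := fun t => (t - 0)⁻¹ • g t) hρ.le]
    · refine Complex.circleIntegral_sub_inv_smul_of_differentiable_on_off_countable
        Set.countable_empty (Metric.mem_ball_self hρ)
        (hg.continuousOn.mono (Metric.closedBall_subset_ball hρr)) fun t ht => ?_
      exact hg.differentiableAt (Metric.isOpen_ball.mem_nhds (Metric.ball_subset_ball hρr.le ht.1))
    · intro t ht
      have h1 : (k : ℤ) + (-1 - lam) = -1 := by omega
      simp only
      rw [← mul_assoc, ← zpow_natCast, ← zpow_add₀ (hne t ht), h1, zpow_neg_one, sub_zero,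
        smul_eq_mul]

/-! ### Growth of the kernel along a ray -/

/-- Provides the direction of steepest growth, in which the leading exponent is real and positive.
-/
lemma exists_norm_eq_one_pow_eq {q : ℕ} (hq : q ≠ 0) {c : ℂ} (hc : c ≠ 0) :
    ∃ ζ : ℂ, ‖ζ‖ = 1 ∧ -c / ζ ^ q = ‖c‖ := by
  have hc' : (‖c‖ : ℂ) ≠ 0 := by simpa using hc
  obtain ⟨ζ, hζ⟩ := IsAlgClosed.exists_pow_nat_eq (-c / ‖c‖) (Nat.pos_of_ne_zero hq)
  refine ⟨ζ, ?_, ?_⟩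
  · have : ‖ζ‖ ^ q = 1 := by
      rw [← norm_pow, hζ]
      simp [hc]
    exact (pow_eq_one_iff_of_nonneg (norm_nonneg _) hq).1 this
  · rw [hζ]
    field_simp

/-- Half of the exponent `c u^q` absorbs `C u^τ`, the other half beats the power of `u`. -/
lemma eventually_lt_mul_exp_pow {q : ℕ} {c c' : ℝ} (hc : 0 < c) (hc' : 0 < c') {τ : ℝ}
    (hτ : τ < q) (hτ0 : 0 ≤ τ) (A C : ℝ) (N : ℕ) :
    ∀ᶠ u : ℝ in atTop, A * u ^ N * Real.exp (C * u ^ τ) < c' * Real.exp (c * u ^ q) := by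
  have h1 : Tendsto (fun u : ℝ => u ^ ((q : ℝ) - τ)) atTop atTop :=
    tendsto_rpow_atTop (by linarith)
  have hq : 1 ≤ q := by
    have : (0 : ℝ) < q := by linarith
    exact_mod_cast this
  have h2 : Tendsto (fun u : ℝ => u ^ N * Real.exp (-(c / 2) * u)) atTop (𝓝 0) := by
    have h3 := (isLittleO_pow_exp_pos_mul_atTop N (half_pos hc)).tendsto_div_nhds_zero
    refine h3.congr fun u => ?_
    rw [neg_mul, Real.exp_neg, div_eq_mul_inv]
  have h3 : Tendsto (fun u : ℝ => |A| * (u ^ N * Real.exp (-(c / 2) * u))) atTop (𝓝 0) := by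
    simpa using h2.const_mul |A|
  filter_upwards [h1.eventually_ge_atTop (2 * C / c), eventually_ge_atTop 1,
    h3.eventually_lt_const hc'] with u hu1 hu hu3
  have hu0 : 0 < u := by linarith
  have e1 : C * u ^ τ ≤ c / 2 * u ^ q := by
    have e2 : u ^ q = u ^ ((q : ℝ) - τ) * u ^ τ := by
      rw [← Real.rpow_add hu0]; simp
    have e3 : 0 < u ^ τ := Real.rpow_pos_of_pos hu0 _
    rw [e2, ← mul_assoc]
    gcongr
    rw [div_le_iff₀ hc] at hu1
    linarith
  have e4 : u ≤ u ^ q := le_self_pow₀ hu (by omega)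
  calc A * u ^ N * Real.exp (C * u ^ τ)
      ≤ |A| * u ^ N * Real.exp (c / 2 * u ^ q) := by gcongr; exact le_abs_self A
    _ = |A| * (u ^ N * Real.exp (-(c / 2) * u ^ q)) * Real.exp (c * u ^ q) := by
        have : Real.exp (c / 2 * u ^ q) =
            Real.exp (-(c / 2) * u ^ q) * Real.exp (c * u ^ q) := by
          rw [← Real.exp_add]; ring_nf
        rw [this]; ring
    _ ≤ |A| * (u ^ N * Real.exp (-(c / 2) * u)) * Real.exp (c * u ^ q) := by
        gcongr ?_ * Real.exp _
        refine mul_le_mul_of_nonneg_left (mul_le_mul_of_nonneg_left (Real.exp_le_exp.2 ?_)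
          (by positivity)) (abs_nonneg _)
        nlinarith
    _ < c' * Real.exp (c * u ^ q) := by gcongr

/-- Along a suitable ray, `t ^ m g(t) exp (-e(t) / t ^ q)` grows faster near the origin than any
function of order less than `q` in `1 / t`. -/
lemma exists_ray_growth {q : ℕ} (hq : q ≠ 0) {r : ℝ} (hr : 0 < r) {g e φ : ℂ → ℂ} {m : ℤ}
    (hg : DifferentiableOn ℂ g (Metric.ball 0 r)) (hg0 : g 0 ≠ 0)
    (he : DifferentiableOn ℂ e (Metric.ball 0 r)) (he0 : e 0 ≠ 0)
    (hφ : ∀ t ∈ Metric.ball (0 : ℂ) r \ {0},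
      φ t = t ^ m * g t * Complex.exp (-(e t / t ^ q))) :
    ∃ ζ : ℂ, ‖ζ‖ = 1 ∧ ∀ τ : ℝ, 0 ≤ τ → τ < q → ∀ (A C : ℝ) (N : ℕ), ∀ᶠ u : ℝ in atTop,
      A * u ^ N * Real.exp (C * u ^ τ) < ‖φ (ζ * ((u⁻¹ : ℝ) : ℂ))‖ := by
  obtain ⟨ζ, hζ, hζq⟩ := exists_norm_eq_one_pow_eq hq he0
  have hζ0 : ζ ≠ 0 := norm_ne_zero_iff.1 (by rw [hζ]; exact one_ne_zero)
  refine ⟨ζ, hζ, fun τ hτ0 hτ A C N => ?_⟩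
  have hnhds := Metric.ball_mem_nhds (0 : ℂ) hr
  have hlim : Tendsto (fun u : ℝ => ζ * ((u⁻¹ : ℝ) : ℂ)) atTop (𝓝 0) := by
    have h1 : Tendsto (fun u : ℝ => ((u⁻¹ : ℝ) : ℂ)) atTop (𝓝 ((0 : ℝ) : ℂ)) :=
      (Complex.continuous_ofReal.tendsto 0).comp tendsto_inv_atTop_zero
    simpa using h1.const_mul ζ
  have hgc : ContinuousAt (fun t => ‖g t‖) 0 := (hg.differentiableAt hnhds).continuousAt.norm
  have hec : ContinuousAt (fun t => (-e t / ζ ^ q).re) 0 :=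
    Complex.continuous_re.continuousAt.comp
      ((he.differentiableAt hnhds).continuousAt.neg.div_const _)
  have hgn : 0 < ‖g 0‖ := norm_pos_iff.2 hg0
  have hen : 0 < ‖e 0‖ := norm_pos_iff.2 he0
  have hg' : ∀ᶠ t in 𝓝 (0 : ℂ), ‖g 0‖ / 2 < ‖g t‖ := hgc.eventually_const_lt (by linarith)
  have he' : ∀ᶠ t in 𝓝 (0 : ℂ), ‖e 0‖ / 2 < (-e t / ζ ^ q).re := by
    refine hec.eventually_const_lt ?_
    simp only [hζq, Complex.ofReal_re]
    linarith
  -- The extra power `m.natAbs` pays for the factor `‖t‖ ^ m`, which is at least `u ^ (-|m|)`.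
  filter_upwards [hlim.eventually (hg'.and (he'.and hnhds)), eventually_ge_atTop 1,
    eventually_lt_mul_exp_pow (half_pos hen) (half_pos hgn) hτ hτ0 A C (N + m.natAbs)]
    with u ⟨h1, h2, h3⟩ hu h4
  have hu0 : 0 < u := by linarith
  have huc : (u : ℂ) ≠ 0 := by exact_mod_cast hu0.ne'
  set t := ζ * ((u⁻¹ : ℝ) : ℂ) with ht
  have ht0 : t ≠ 0 := mul_ne_zero hζ0 (by simpa using huc)
  have htn : ‖t‖ = u⁻¹ := by simp [ht, hζ, abs_of_pos hu0]
  have hexp : (-(e t / t ^ q)).re = u ^ q * (-e t / ζ ^ q).re := by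
    have : -(e t / t ^ q) = ((u ^ q : ℝ) : ℂ) * (-e t / ζ ^ q) := by
      generalize e t = E
      rw [ht, mul_pow]
      push_cast
      rw [inv_pow]
      field_simp
    rw [this, Complex.re_ofReal_mul]
  have hpow : (u ^ m.natAbs)⁻¹ ≤ ‖t‖ ^ m := by
    rw [htn, inv_zpow, ← zpow_natCast]
    exact inv_anti₀ (zpow_pos hu0 _) (zpow_le_zpow_right₀ hu (by omega))
  rw [hφ t ⟨h3, ht0⟩, norm_mul, norm_mul, norm_zpow, Complex.norm_exp, hexp]
  calc A * u ^ N * Real.exp (C * u ^ τ)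
      = (u ^ m.natAbs)⁻¹ * (A * u ^ (N + m.natAbs) * Real.exp (C * u ^ τ)) := by
        rw [pow_add]; field_simp
    _ < (u ^ m.natAbs)⁻¹ * (‖g 0‖ / 2 * Real.exp (‖e 0‖ / 2 * u ^ q)) := by gcongr
    _ ≤ ‖t‖ ^ m * (‖g t‖ * Real.exp (u ^ q * (-e t / ζ ^ q).re)) := by
        rw [mul_comm (‖e 0‖ / 2)]
        gcongr
    _ = _ := by ring

/-- A meromorphic function has at most polynomial growth in `1 / t`. -/
lemma MeromorphicAt.exists_norm_le {φ : ℂ → ℂ} (hφ : MeromorphicAt φ 0) :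
    ∃ (A : ℝ) (N : ℕ), ∀ᶠ t in 𝓝[≠] (0 : ℂ), ‖φ t‖ ≤ A * (‖t‖⁻¹) ^ N := by
  obtain ⟨N, hN⟩ := hφ
  have hc : ContinuousAt (fun t => ‖(t - 0) ^ N • φ t‖) 0 := hN.continuousAt.norm
  refine ⟨‖((0 : ℂ) - 0) ^ N • φ 0‖ + 1, N, ?_⟩
  filter_upwards [nhdsWithin_le_nhds (hc.eventually_lt_const (lt_add_one _)),
    self_mem_nhdsWithin] with t h1 h2
  have ht : 0 < ‖t‖ := norm_pos_iff.2 h2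
  rw [sub_zero, norm_smul, norm_pow] at h1
  rw [inv_pow, ← div_eq_mul_inv, le_div_iff₀ (by positivity), mul_comm]
  exact h1.le

lemma not_meromorphicAt_of_ray_growth {φ : ℂ → ℂ} {ζ : ℂ} {q : ℕ} (hq : q ≠ 0) (hζ : ‖ζ‖ = 1)
    (h : ∀ τ : ℝ, 0 ≤ τ → τ < q → ∀ (A C : ℝ) (N : ℕ), ∀ᶠ u : ℝ in atTop,
      A * u ^ N * Real.exp (C * u ^ τ) < ‖φ (ζ * ((u⁻¹ : ℝ) : ℂ))‖) :
    ¬ MeromorphicAt φ 0 := by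
  intro hm
  obtain ⟨A, N, hA⟩ := hm.exists_norm_le
  have hζ0 : ζ ≠ 0 := norm_ne_zero_iff.1 (by rw [hζ]; exact one_ne_zero)
  have hlim : Tendsto (fun u : ℝ => ζ * ((u⁻¹ : ℝ) : ℂ)) atTop (𝓝 0) := by
    have h1 : Tendsto (fun u : ℝ => ((u⁻¹ : ℝ) : ℂ)) atTop (𝓝 ((0 : ℝ) : ℂ)) :=
      (Complex.continuous_ofReal.tendsto 0).comp tendsto_inv_atTop_zero
    simpa using h1.const_mul ζ
  obtain ⟨u, h1, h2, h3⟩ := ((hlim.eventually (eventually_nhdsWithin_iff.1 hA)).and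
    ((eventually_gt_atTop 0).and
      (h 0 le_rfl (by exact_mod_cast Nat.pos_of_ne_zero hq) A 0 N))).exists
  have h4 := h1 (mul_ne_zero hζ0 (by simpa using h2.ne'))
  have h5 : ‖ζ * ((u⁻¹ : ℝ) : ℂ)‖⁻¹ = u := by simp [hζ, abs_of_pos h2]
  rw [h5] at h4
  simp only [zero_mul, Real.exp_zero, mul_one] at h3
  exact absurd h4 (not_le.2 h3)

/-! ### Order of growth -/

lemma norm_le_maxModulus {f : ℂ → ℂ} (hf : Continuous f) (z : ℂ) : ‖f z‖ ≤ maxModulus f ‖z‖ :=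
  le_csSup ((isCompact_sphere (0 : ℂ) ‖z‖).image hf.norm).bddAbove
    (Set.mem_image_of_mem (fun z => ‖f z‖) (by simp))

lemma maxModulus_nonneg (f : ℂ → ℂ) (r : ℝ) : 0 ≤ maxModulus f r :=
  Real.sSup_nonneg (by rintro _ ⟨z, -, rfl⟩; exact norm_nonneg _)

lemma maxModulus_le {f : ℂ → ℂ} {r C : ℝ} (hr : 0 ≤ r) (hC : ∀ z, ‖z‖ = r → ‖f z‖ ≤ C) :
    maxModulus f r ≤ C := by
  refine csSup_le ((NormedSpace.sphere_nonempty.2 hr).image _) ?_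
  rintro _ ⟨z, hz, rfl⟩
  exact hC z (by simpa using hz)

lemma norm_iteratedDeriv_le_maxModulus {w : ℂ → ℂ} (hw : Differentiable ℂ w) (k : ℕ) {R : ℝ}
    (hR : 0 < R) : ‖iteratedDeriv k w 0‖ ≤ k.factorial * maxModulus w R / R ^ k := by
  refine Complex.norm_iteratedDeriv_le_of_forall_mem_sphere_norm_le k hR hw.diffContOnCl ?_
  intro z hz
  rw [← mem_sphere_zero_iff_norm.1 hz]
  exact norm_le_maxModulus hw.continuous z

/-- By Cauchy's estimate `M(r)` is at least a constant times `r^k`. This keeps `log M` positive, so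
that the iterated logarithm is genuine. -/
lemma eventually_one_lt_maxModulus {w : ℂ → ℂ} (hw : Differentiable ℂ w) {k : ℕ} (hk : k ≠ 0)
    (hd : iteratedDeriv k w 0 ≠ 0) : ∀ᶠ r in atTop, 1 < maxModulus w r := by
  have hpos : 0 < ‖iteratedDeriv k w 0‖ := norm_pos_iff.2 hd
  filter_upwards [(tendsto_pow_atTop hk).eventually_gt_atTop
    ((k.factorial : ℝ) / ‖iteratedDeriv k w 0‖), eventually_gt_atTop 0] with r h1 h2
  have h3 := norm_iteratedDeriv_le_maxModulus hw k h2
  rw [le_div_iff₀ (by positivity)] at h3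
  rw [div_lt_iff₀ hpos] at h1
  have h4 : (0 : ℝ) < k.factorial := by exact_mod_cast k.factorial_pos
  nlinarith

lemma growthOrder_le_of_eventually_le {w : ℂ → ℂ} {s B C : ℝ}
    (h1 : ∀ᶠ r in atTop, 1 < maxModulus w r)
    (hs : 0 ≤ s) (h2 : ∀ᶠ r in atTop, maxModulus w r ≤ B * Real.exp (C * r ^ s)) :
    growthOrder w ≤ (s : EReal) := by
  set D : ℝ := |Real.log B| + |C| + 1
  have hD : 0 < D := by positivity
  have hlim : Tendsto (fun r : ℝ => ((Real.log D / Real.log r + s : ℝ) : EReal)) atTop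
      (𝓝 ((s : ℝ) : EReal)) := by
    refine (continuous_coe_real_ereal.tendsto s).comp ?_
    simpa using (Real.tendsto_log_atTop.const_div_atTop (Real.log D)).add_const s
  rw [growthOrder, ← hlim.limsup_eq]
  refine limsup_le_limsup ?_
  filter_upwards [h1, h2, eventually_gt_atTop 1] with r hr1 hr2 hr
  have hr0 : 0 < r := by linarith
  have hlog : 0 < Real.log r := Real.log_pos hr
  have hrs : 1 ≤ r ^ s := Real.one_le_rpow hr.le hs
  have hB : 0 < B := by
    by_contra hB
    have := mul_nonpos_of_nonpos_of_nonneg (not_lt.1 hB) (Real.exp_pos (C * r ^ s)).le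
    linarith
  have e1 : Real.log (maxModulus w r) ≤ D * r ^ s := by
    have := Real.log_le_log (by linarith) hr2
    rw [Real.log_mul hB.ne' (Real.exp_pos _).ne', Real.log_exp] at this
    have i1 := le_abs_self (Real.log B)
    have i2 : C * r ^ s ≤ |C| * r ^ s := by gcongr; exact le_abs_self C
    have i3 : |Real.log B| ≤ |Real.log B| * r ^ s := le_mul_of_one_le_right (abs_nonneg _) hrs
    have : D * r ^ s = |Real.log B| * r ^ s + |C| * r ^ s + r ^ s := by ring
    linarith
  have e2 := Real.log_le_log (Real.log_pos hr1) e1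
  rw [Real.log_mul hD.ne' (by positivity), Real.log_rpow hr0] at e2
  have e3 : Real.log (Real.log (maxModulus w r)) / Real.log r ≤ Real.log D / Real.log r + s := by
    rw [div_le_iff₀ hlog, add_mul, div_mul_cancel₀ _ hlog.ne']
    exact e2
  exact_mod_cast e3

lemma eventually_maxModulus_le_of_growthOrder_lt {w : ℂ → ℂ} {σ : ℝ}
    (h : growthOrder w < (σ : EReal)) :
    ∀ᶠ r in atTop, maxModulus w r ≤ Real.exp (r ^ σ) := by
  filter_upwards [eventually_lt_of_limsup_lt h, eventually_gt_atTop 1] with r h1 hr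
  have hr0 : 0 < r := by linarith
  have hlog : 0 < Real.log r := Real.log_pos hr
  have h2 : Real.log (Real.log (maxModulus w r)) / Real.log r < σ := by exact_mod_cast h1
  rw [div_lt_iff₀ hlog] at h2
  -- `x ≤ exp (log x)` holds for every real `x` under the conventions for `Real.log`, so no lower
  -- bound on `M` is needed.
  refine (Real.le_exp_log _).trans (Real.exp_le_exp.2 ((Real.le_exp_log _).trans ?_))
  rw [Real.rpow_def_of_pos hr0, mul_comm]
  exact Real.exp_le_exp.2 h2.le

/-- A Young-type inequality: according to whether `v` is below or above `R^(1-σ)`, the first or the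
second term alone suffices. -/
lemma rpow_le_div_add_rpow {σ R v : ℝ} (hσ : 0 < σ) (hσ1 : σ < 1) (hR : 0 < R) (hv : 0 < v) :
    R ^ σ ≤ R / v + v ^ (σ / (1 - σ)) := by
  have h1σ : 0 < 1 - σ := by linarith
  rcases le_total v (R ^ (1 - σ)) with h | h
  · have : R ^ σ * v ≤ R := by
      calc R ^ σ * v ≤ R ^ σ * R ^ (1 - σ) := by gcongr
        _ = R := by rw [← Real.rpow_add hR]; simp
    have h2 : 0 ≤ v ^ (σ / (1 - σ)) := by positivity
    have : R ^ σ ≤ R / v := (le_div_iff₀ hv).2 this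
    linarith
  · have h2 : 0 ≤ R / v := by positivity
    have : R ^ σ ≤ v ^ (σ / (1 - σ)) := by
      calc R ^ σ = (R ^ (1 - σ)) ^ (σ / (1 - σ)) := by
            rw [← Real.rpow_mul hR.le]; congr 1; field_simp
        _ ≤ v ^ (σ / (1 - σ)) := by gcongr
    linarith

/-- Coefficient bounds for entire functions of order less than `1`, in a form adapted to
Borel transforms. -/
lemma eventually_norm_iteratedDeriv_le {w : ℂ → ℂ} (hw : Differentiable ℂ w) {σ : ℝ}
    (hσ : 0 < σ) (hσ1 : σ < 1) (h : ∀ᶠ r in atTop, maxModulus w r ≤ Real.exp (r ^ σ)) :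
    ∀ᶠ u : ℝ in atTop, ∀ k : ℕ, ‖iteratedDeriv k w 0‖ ≤
      Real.exp 1 * Real.exp (8 ^ (σ / (1 - σ)) * u ^ (σ / (1 - σ))) * (1 / 2) ^ k * u⁻¹ ^ k := by
  obtain ⟨R₀, hR₀⟩ := eventually_atTop.1 h
  filter_upwards [eventually_ge_atTop R₀, eventually_gt_atTop 0] with u hu hu0 k
  -- With `v = 8u` the linear term `R/v` is `k + 1`. Then `(k+1)^k` cancels against `R^k`, leaving
  -- `(e/8)^k ≤ (1/2)^k`.
  set R : ℝ := 8 * u * (k + 1) with hR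
  have hRp : 0 < R := by positivity
  have hRge : R₀ ≤ R := by
    have : (0 : ℝ) ≤ k := k.cast_nonneg
    nlinarith
  have h1 : R ^ σ ≤ (k + 1) + 8 ^ (σ / (1 - σ)) * u ^ (σ / (1 - σ)) := by
    refine (rpow_le_div_add_rpow hσ hσ1 hRp (show 0 < 8 * u by positivity)).trans ?_
    rw [Real.mul_rpow (by norm_num) hu0.le, hR]
    refine add_le_add_left (le_of_eq ?_) _
    field_simp
  have h2 : (k.factorial : ℝ) ≤ (k + 1) ^ k := by
    exact_mod_cast k.factorial_le_pow.trans (Nat.pow_le_pow_left (by omega) k)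
  have h3 : Real.exp 1 / 8 ≤ 1 / 2 := by
    have := Real.exp_one_lt_d9
    linarith
  calc ‖iteratedDeriv k w 0‖ ≤ k.factorial * maxModulus w R / R ^ k :=
        norm_iteratedDeriv_le_maxModulus hw k hRp
    _ ≤ (k + 1) ^ k * Real.exp ((k + 1) + 8 ^ (σ / (1 - σ)) * u ^ (σ / (1 - σ))) / R ^ k := by
        gcongr
        · exact maxModulus_nonneg w R
        · exact (hR₀ R hRge).trans (Real.exp_le_exp.2 h1)
    _ = Real.exp 1 * Real.exp (8 ^ (σ / (1 - σ)) * u ^ (σ / (1 - σ))) * (Real.exp 1 / 8) ^ k *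
          u⁻¹ ^ k := by
        have : Real.exp (k : ℝ) = Real.exp 1 ^ k := by rw [← Real.exp_nat_mul, mul_one]
        rw [hR, Real.exp_add, Real.exp_add, this, mul_pow, mul_pow, div_pow, inv_pow]
        field_simp
    _ ≤ _ := by gcongr

/-- An upper bound for `t ^ m g(t) exp (-e(t) / t ^ q)` near the origin. -/
lemma exists_norm_le_mul_exp {q : ℕ} (hq : q ≠ 0) {r : ℝ} (hr : 0 < r) {g e φ : ℂ → ℂ} {m : ℤ}
    (hg : DifferentiableOn ℂ g (Metric.ball 0 r)) (he : DifferentiableOn ℂ e (Metric.ball 0 r))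
    (hφ : ∀ t ∈ Metric.ball (0 : ℂ) r \ {0},
      φ t = t ^ m * g t * Complex.exp (-(e t / t ^ q))) :
    ∃ B C r' : ℝ, 0 ≤ B ∧ 0 < r' ∧ r' < r ∧ ∀ t : ℂ, t ≠ 0 → ‖t‖ ≤ r' →
      ‖φ t‖ ≤ B * Real.exp (C * ‖t‖⁻¹ ^ q) := by
  -- The bound `r' ≤ 1` gives `‖t‖⁻¹ ≥ 1`, so the power `t^m` is absorbed into an exponential of
  -- `‖t‖⁻¹ ^ q`.
  set r' := min (r / 2) 1
  have hr' : 0 < r' := by positivity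
  have hrr : r' < r := (min_le_left _ _).trans_lt (by linarith)
  have hsub : Metric.closedBall (0 : ℂ) r' ⊆ Metric.ball 0 r := Metric.closedBall_subset_ball hrr
  obtain ⟨Mg, hMg⟩ := (isCompact_closedBall (0 : ℂ) r').exists_bound_of_continuousOn
    (hg.continuousOn.mono hsub)
  obtain ⟨Me, hMe⟩ := (isCompact_closedBall (0 : ℂ) r').exists_bound_of_continuousOn
    (he.continuousOn.mono hsub)
  have hMg0 : 0 ≤ Mg := (norm_nonneg _).trans (hMg 0 (by simp [hr'.le]))
  refine ⟨m.natAbs.factorial * Mg, 1 + Me, r', by positivity, hr', hrr, fun t ht htr => ?_⟩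
  have hmem : t ∈ Metric.closedBall (0 : ℂ) r' := by simpa using htr
  have ht0 : 0 < ‖t‖ := norm_pos_iff.2 ht
  have ht1 : 1 ≤ ‖t‖⁻¹ := (one_le_inv₀ ht0).2 (htr.trans (min_le_right _ _))
  have h1 : ‖t‖ ^ m ≤ m.natAbs.factorial * Real.exp (‖t‖⁻¹ ^ q) := by
    calc ‖t‖ ^ m = ‖t‖⁻¹ ^ (-m) := by rw [inv_zpow, zpow_neg, inv_inv]
      _ ≤ ‖t‖⁻¹ ^ ((m.natAbs : ℕ) : ℤ) := zpow_le_zpow_right₀ ht1 (by omega)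
      _ = ‖t‖⁻¹ ^ m.natAbs := zpow_natCast _ _
      _ ≤ m.natAbs.factorial * Real.exp (‖t‖⁻¹) := by
          have := Real.pow_div_factorial_le_exp ‖t‖⁻¹ (by positivity) m.natAbs
          rw [div_le_iff₀ (by positivity)] at this
          linarith
      _ ≤ m.natAbs.factorial * Real.exp (‖t‖⁻¹ ^ q) := by
          gcongr
          exact le_self_pow₀ ht1 hq
  have h2 : ‖Complex.exp (-(e t / t ^ q))‖ ≤ Real.exp (Me * ‖t‖⁻¹ ^ q) := by
    refine (Complex.norm_exp_le_exp_norm _).trans (Real.exp_le_exp.2 ?_)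
    rw [norm_neg, norm_div, norm_pow, div_eq_mul_inv, inv_pow]
    gcongr
    exact hMe t hmem
  rw [hφ t ⟨hsub hmem, ht⟩, norm_mul, norm_mul, norm_zpow]
  calc ‖t‖ ^ m * ‖g t‖ * ‖Complex.exp (-(e t / t ^ q))‖
      ≤ (m.natAbs.factorial * Real.exp (‖t‖⁻¹ ^ q)) * Mg * Real.exp (Me * ‖t‖⁻¹ ^ q) := by
        gcongr
        exact hMg t hmem
    _ = _ := by rw [add_mul, one_mul, Real.exp_add]; ring

/-- Upper bound for the order of growth of the residue, by the choice of the radius of the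
contour. -/
lemma eventually_maxModulus_le_of_kernel_le {q : ℕ} {φ w : ℂ → ℂ} {B C r' r : ℝ}
    (hB : 0 ≤ B) (hr' : 0 < r') (hrr : r' < r)
    (hφ : ∀ t : ℂ, t ≠ 0 → ‖t‖ ≤ r' → ‖φ t‖ ≤ B * Real.exp (C * ‖t‖⁻¹ ^ q))
    (hw : ∀ ρ, 0 < ρ → ρ < r → ∀ z, w z =
      (2 * (Real.pi : ℂ) * Complex.I)⁻¹ * ∮ t in C(0, ρ), φ t * Complex.exp (-z * t)) :
    ∀ᶠ x : ℝ in atTop,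
      maxModulus w x ≤ B * Real.exp ((C + 1) * x ^ (1 - 1 / ((q : ℝ) + 1))) := by
  have hq : (0 : ℝ) < q + 1 := by positivity
  have hlim : Tendsto (fun x : ℝ => x ^ (-(1 / ((q : ℝ) + 1)))) atTop (𝓝 0) :=
    tendsto_rpow_neg_atTop (by positivity)
  filter_upwards [hlim.eventually_lt_const (lt_min hr' one_pos), eventually_gt_atTop 0]
    with x hx hx0
  -- This radius balances the two exponents: `ρ^(-q) = xρ`.
  set ρ := x ^ (-(1 / ((q : ℝ) + 1))) with hρ
  have hρ0 : 0 < ρ := Real.rpow_pos_of_pos hx0 _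
  have hρr : ρ < r' := hx.trans_le (min_le_left _ _)
  have hρ1 : ρ ≤ 1 := (hx.trans_le (min_le_right _ _)).le
  have e1 : ρ⁻¹ ^ q = x ^ (1 - 1 / ((q : ℝ) + 1)) := by
    rw [hρ, ← Real.rpow_neg hx0.le, neg_neg, ← Real.rpow_natCast, ← Real.rpow_mul hx0.le]
    congr 1
    field_simp
    ring
  have e2 : x * ρ = x ^ (1 - 1 / ((q : ℝ) + 1)) := by
    rw [hρ, sub_eq_add_neg, Real.rpow_add hx0, Real.rpow_one]
  refine maxModulus_le hx0.le fun z hz => ?_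
  rw [hw ρ hρ0 (hρr.trans hrr), ← smul_eq_mul]
  refine (circleIntegral.norm_two_pi_i_inv_smul_integral_le_of_norm_le_const hρ0.le
    (C := B * Real.exp ((C + 1) * x ^ (1 - 1 / ((q : ℝ) + 1)))) fun t ht => ?_).trans
      (mul_le_of_le_one_left (by positivity) hρ1)
  have htn := mem_sphere_zero_iff_norm.1 ht
  have h1 := hφ t (norm_pos_iff.1 (htn ▸ hρ0)) (htn ▸ hρr.le)
  rw [htn, e1] at h1
  have h2 : ‖Complex.exp (-z * t)‖ ≤ Real.exp (x ^ (1 - 1 / ((q : ℝ) + 1))) := by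
    refine (Complex.norm_exp_le_exp_norm _).trans (Real.exp_le_exp.2 ?_)
    rw [norm_mul, norm_neg, hz, htn, e2]
  rw [norm_mul, add_mul, one_mul, Real.exp_add, ← mul_assoc]
  gcongr

/-- The order of growth of the residue at an essential singularity of exponential type `q` in
`1 / t`. -/
lemma growthOrder_eq_of_kernel_growth {q : ℕ} (hq : q ≠ 0) {φ w : ℂ → ℂ} {B C r' r : ℝ} {ζ : ℂ}
    (hd : DifferentiableOn ℂ φ (Metric.ball 0 r \ {0}))
    (hB : 0 ≤ B) (hr' : 0 < r') (hrr : r' < r)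
    (hφ : ∀ t : ℂ, t ≠ 0 → ‖t‖ ≤ r' → ‖φ t‖ ≤ B * Real.exp (C * ‖t‖⁻¹ ^ q))
    (hζ : ‖ζ‖ = 1)
    (hray : ∀ τ : ℝ, 0 ≤ τ → τ < q → ∀ (A C : ℝ) (N : ℕ), ∀ᶠ u : ℝ in atTop,
      A * u ^ N * Real.exp (C * u ^ τ) < ‖φ (ζ * ((u⁻¹ : ℝ) : ℂ))‖)
    (hw : ∀ ρ, 0 < ρ → ρ < r → ∀ z, w z =
      (2 * (Real.pi : ℂ) * Complex.I)⁻¹ * ∮ t in C(0, ρ), φ t * Complex.exp (-z * t)) :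
    growthOrder w = ((1 - 1 / ((q : ℝ) + 1) : ℝ) : EReal) := by
  have hq1 : (1 : ℝ) ≤ q := by exact_mod_cast Nat.one_le_iff_ne_zero.2 hq
  have hζ0 : ζ ≠ 0 := norm_ne_zero_iff.1 (by rw [hζ]; exact one_ne_zero)
  have hcont := hd.continuousOn.mono (sphere_subset_puncturedBall hr' hrr)
  have hweq : w = fun z => (2 * (Real.pi : ℂ) * Complex.I)⁻¹ *
      ∮ t in C(0, r'), φ t * Complex.exp (-z * t) := funext (hw r' hr' hrr)
  have hwd : Differentiable ℂ w := by
    rw [hweq]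
    exact fun z => ((hasDerivAt_circleIntegral_mul_exp hr' hcont z).const_mul _).differentiableAt
  have hmom : ∀ k : ℕ, ‖∮ s in C(0, r'), s ^ k * φ s‖ =
      2 * Real.pi * ‖iteratedDeriv k w 0‖ := by
    intro k
    rw [hweq, iteratedDeriv_zero_const_mul_circleIntegral_mul_exp hr' hcont]
    have := Real.pi_pos
    simp only [norm_mul, norm_inv, norm_pow, norm_neg, norm_one, one_pow, Complex.norm_I,
      Complex.norm_real, Complex.norm_ofNat, Real.norm_eq_abs, abs_of_pos Real.pi_pos]
    field_simp
  obtain ⟨A, hA0, hA⟩ := exists_norm_le_of_moments_le hd hr' hrr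
  have hu : ∀ᶠ u : ℝ in atTop, 1 ≤ u ∧ u⁻¹ ≤ r' / 2 :=
    (eventually_ge_atTop 1).and
      ((tendsto_inv_atTop_zero.eventually_lt_const (half_pos hr')).mono fun u h => h.le)
  have hnorm : ∀ u : ℝ, 1 ≤ u → ‖ζ * ((u⁻¹ : ℝ) : ℂ)‖ = u⁻¹ ∧ ζ * ((u⁻¹ : ℝ) : ℂ) ≠ 0 := by
    intro u hu
    have : 0 < u := by linarith
    exact ⟨by simp [hζ, abs_of_pos this], mul_ne_zero hζ0 (by simpa using this.ne')⟩
  -- Otherwise the principal part of `φ` would reduce to a multiple of `1/t`, contradicting the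
  -- growth on the ray already with `τ = 0`, `N = 1`.
  have hk : ∃ k, k ≠ 0 ∧ iteratedDeriv k w 0 ≠ 0 := by
    by_contra! hk
    set c := ‖∮ s in C(0, r'), s ^ 0 * φ s‖
    obtain ⟨u, ⟨hu1, hu2⟩, hu3⟩ := (hu.and
      (hray 0 le_rfl (by linarith) (A + 2 * c) 0 1)).exists
    obtain ⟨hn, hne⟩ := hnorm u hu1
    have h1 := hA _ hne (hn.le.trans hu2) c (1 / 2) (norm_nonneg _) (by norm_num) (by norm_num) ?_
    · rw [hn] at h1
      have h2 : c / ((1 - 1 / 2) * u⁻¹) = 2 * c * u := by field_simp; norm_num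
      rw [h2] at h1
      simp only [zero_mul, Real.exp_zero, mul_one, pow_one] at hu3
      have : A ≤ A * u := le_mul_of_one_le_right hA0 hu1
      linarith
    · intro k
      rcases eq_or_ne k 0 with rfl | hk0
      · simp [c]
      · rw [hmom, hk k hk0, norm_zero, mul_zero]
        positivity
  obtain ⟨k, hk0, hk⟩ := hk
  have hs0 : 0 < 1 - 1 / ((q : ℝ) + 1) := by
    have : 1 / ((q : ℝ) + 1) < 1 := by rw [div_lt_one (by linarith)]; linarith
    linarith
  refine le_antisymm (growthOrder_le_of_eventually_le (eventually_one_lt_maxModulus hwd hk0 hk)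
    hs0.le (eventually_maxModulus_le_of_kernel_le hB hr' hrr hφ hw)) ?_
  by_contra! hlt
  obtain ⟨σ₀, hσ₀, hσ₀'⟩ := EReal.lt_iff_exists_real_btwn.1 hlt
  have hσ₀'' : σ₀ < 1 - 1 / ((q : ℝ) + 1) := by exact_mod_cast hσ₀'
  -- The maximum only ensures `σ > 0`.
  set σ := max σ₀ ((1 - 1 / ((q : ℝ) + 1)) / 2) with hσdef
  have hσ : 0 < σ := lt_max_of_lt_right (by linarith)
  have hσs : σ < 1 - 1 / ((q : ℝ) + 1) := max_lt hσ₀'' (by linarith)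
  have hσ1 : σ < 1 := by
    have : 0 < 1 / ((q : ℝ) + 1) := by positivity
    linarith
  -- The map `σ ↦ σ/(1-σ)` is increasing and takes the value `q` at `1 - 1/(q+1)`.
  have hτq : σ / (1 - σ) < q := by
    rw [div_lt_iff₀ (by linarith)]
    have : (1 - 1 / ((q : ℝ) + 1)) * (q + 1) = q := by field_simp; ring
    nlinarith
  have hgrow : growthOrder w < (σ : EReal) :=
    hσ₀.trans_le (by exact_mod_cast le_max_left _ _)
  have hder := eventually_norm_iteratedDeriv_le hwd hσ hσ1
    (eventually_maxModulus_le_of_growthOrder_lt hgrow)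
  set τ := σ / (1 - σ) with hτ
  have hτ0 : 0 ≤ τ := div_nonneg hσ.le (by linarith)
  obtain ⟨u, ⟨hu1, hu2⟩, hu3, hu4⟩ := (hu.and (hder.and
    (hray τ hτ0 hτq (A + 2 * (2 * Real.pi * Real.exp 1)) (8 ^ τ) 1))).exists
  obtain ⟨hn, hne⟩ := hnorm u hu1
  set E := Real.exp (8 ^ τ * u ^ τ) with hE
  have hE1 : 1 ≤ E := Real.one_le_exp (by positivity)
  have h1 := hA _ hne (hn.le.trans hu2) (2 * Real.pi * (Real.exp 1 * E)) (1 / 2)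
    (by positivity) (by norm_num) (by norm_num) ?_
  · rw [hn] at h1
    have h2 : 2 * Real.pi * (Real.exp 1 * E) / ((1 - 1 / 2) * u⁻¹) =
        2 * (2 * Real.pi * Real.exp 1) * u * E := by field_simp; norm_num
    rw [h2] at h1
    have h3 : A ≤ A * u * E := by
      rw [mul_assoc]
      exact le_mul_of_one_le_right hA0 (one_le_mul_of_one_le_of_one_le hu1 hE1)
    rw [pow_one, add_mul, add_mul] at hu4
    linarith
  · intro k
    rw [hmom, hn]
    have := hu3 k
    calc 2 * Real.pi * ‖iteratedDeriv k w 0‖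
        ≤ 2 * Real.pi * (Real.exp 1 * E * (1 / 2) ^ k * u⁻¹ ^ k) := by gcongr
      _ = _ := by ring

theorem theorem5 (n : ℕ) (a b : ℕ → ℂ) (hab : a 0 ≠ 0 ∨ b 0 ≠ 0)
    (p : ℕ) (hp : 1 ≤ p)
    (hpole : meromorphicOrderAt (fun t : ℂ => Qzero n a t / Qone n b t) 0 =
      ((-(p : ℤ) : ℤ) : WithTop ℤ))
    (lam : ℤ) (hres : residueAt (fun t : ℂ => Qzero n a t / Qone n b t) 0 = (lam : ℂ)) :
    -- the kernel has a single-valued branch about the pole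
    (∃ r : ℝ, 0 < r ∧ ∃ φ : ℂ → ℂ, IsLaplaceKernelOn n a b φ (Metric.ball 0 r \ {0})) ∧
    -- and every such branch has the asserted properties
    (∀ (r : ℝ), 0 < r → ∀ φ : ℂ → ℂ, IsLaplaceKernelOn n a b φ (Metric.ball 0 r \ {0}) →
      ∀ w : ℂ → ℂ, (∀ z, w z = residueAt (fun t => φ t * Complex.exp (-z * t)) 0) →
        -- `w` is a solution
        IsEntireSolution n a b w ∧
        -- the singularity of the kernel is essential exactly when `p > 1`
        (¬ MeromorphicAt φ 0 ↔ 1 < p) ∧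
        (1 < p → growthOrder w = ((1 - 1 / (p : ℝ) : ℝ) : EReal)) ∧
        (p = 1 →
          (0 ≤ lam → ∃ P : Polynomial ℂ, P ≠ 0 ∧ (P.natDegree : ℤ) = lam ∧
            ∀ z, w z = P.eval z) ∧
          (lam < 0 → ∀ z, w z = 0))) := by
  obtain ⟨q, rfl⟩ := Nat.exists_eq_add_of_le' hp
  obtain ⟨r₀, hr₀, g, e, hg, hg0, he, he0, hex, huniq⟩ :=
    exists_laplaceKernel_normal_form n a b hab q hpole lam hres
  refine ⟨⟨r₀, hr₀, hex⟩, fun r' hr' φ hφ' w hw' => ?_⟩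
  -- The given branch may live on a larger disc; shrinking it does not affect the residue.
  set r := min r' r₀
  have hr : 0 < r := lt_min hr' hr₀
  have hφ : IsLaplaceKernelOn n a b φ (Metric.ball 0 r \ {0}) := fun t ht =>
    hφ' t ⟨Metric.ball_subset_ball (min_le_left _ _) ht.1, ht.2⟩
  obtain ⟨C, hC, hform⟩ := huniq r hr (min_le_right _ _) φ hφ
  have hd := hφ.differentiableOn (isOpen_puncturedBall r)
  have hw : ∀ ρ, 0 < ρ → ρ < r → ∀ z, w z =
      (2 * (Real.pi : ℂ) * Complex.I)⁻¹ * ∮ t in C(0, ρ), φ t * Complex.exp (-z * t) := by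
    intro ρ h0 h1 z
    rw [hw' z]
    exact residueAt_eq_circleIntegral (hd.mul (by fun_prop)) h0 h1
  have hball : Metric.ball (0 : ℂ) r ⊆ Metric.ball 0 r₀ :=
    Metric.ball_subset_ball (min_le_right _ _)
  replace hg : DifferentiableOn ℂ (fun t => C * g t) (Metric.ball 0 r) :=
    (hg.mono hball).const_mul C
  replace he := he.mono hball
  have hg00 : C * g 0 ≠ 0 := mul_ne_zero hC (hg0 0 (Metric.mem_ball_self hr₀))
  have hρ : 0 < r / 2 := by linarith
  have hρr : r / 2 < r := by linarith
  have hweq := funext (hw (r / 2) hρ hρr)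
  have hsol : IsEntireSolution n a b w := hweq ▸ hφ.isEntireSolution hρ hρr _
  refine ⟨hsol, ?_⟩
  rcases Nat.eq_zero_or_pos q with rfl | hq
  -- For `q = 0` the exponential factor is holomorphic at `0` and joins the zero-free factor.
  · set G : ℂ → ℂ := fun t => C * g t * Complex.exp (-e t)
    have hG : DifferentiableOn ℂ G (Metric.ball 0 r) := hg.mul he.neg.cexp
    have hφG : ∀ t ∈ Metric.ball (0 : ℂ) r \ {0}, φ t = t ^ (-1 - lam) * G t := by
      intro t ht
      rw [hform t ht]
      simp [G, mul_assoc]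
    have hmer : MeromorphicAt φ 0 := by
      have h1 : MeromorphicAt (fun t => t ^ (-1 - lam) * G t) 0 :=
        ((MeromorphicAt.id 0).zpow _).mul
          (hG.analyticAt (Metric.ball_mem_nhds 0 hr)).meromorphicAt
      refine h1.congr ?_
      filter_upwards [sdiff_mem_nhdsWithin_compl (Metric.ball_mem_nhds (0 : ℂ) hr) {0}] with t ht
      exact (hφG t ht).symm
    refine ⟨by simpa using hmer, by simp, fun _ => ?_⟩
    have hsub := sphere_subset_puncturedBall hρ hρr
    have hder : ∀ k : ℕ, iteratedDeriv k w 0 = (2 * (Real.pi : ℂ) * Complex.I)⁻¹ * (-1) ^ k *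
        ∮ t in C(0, r / 2), t ^ k * (t ^ (-1 - lam) * G t) := by
      intro k
      rw [hweq, iteratedDeriv_zero_const_mul_circleIntegral_mul_exp hρ (hd.continuousOn.mono hsub)]
      congr 1
      exact circleIntegral.integral_congr hρ.le fun t ht => by
        simp only [hφG t (hsub ht)]
    have hzero : ∀ k : ℕ, lam < k → iteratedDeriv k w 0 = 0 := fun k hk => by
      rw [hder k, (circleIntegral_pow_mul_zpow_mul hG hρ hρr lam k).1 hk, mul_zero]
    constructor
    · intro hlam
      obtain ⟨N, rfl⟩ := Int.eq_ofNat_of_zero_le hlam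
      obtain ⟨P, hP, hPN, hPw⟩ := exists_polynomial_eq_of_iteratedDeriv_eq_zero hsol.1 (N := N)
        (by
          rw [hder N, (circleIntegral_pow_mul_zpow_mul hG hρ hρr N N).2 rfl]
          have h1 := Complex.two_pi_I_ne_zero
          have h2 : G 0 ≠ 0 := mul_ne_zero hg00 (Complex.exp_ne_zero _)
          exact mul_ne_zero (mul_ne_zero (inv_ne_zero h1) (pow_ne_zero _ (by norm_num)))
            (mul_ne_zero h1 h2))
        (fun k hk => hzero k (by exact_mod_cast hk))
      exact ⟨P, hP, by exact_mod_cast hPN, hPw⟩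
    · intro hlam z
      rw [← Complex.taylorSeries_eq_of_entire hsol.1 0 z]
      simp [fun k : ℕ => hzero k (by omega)]
  · have hq0 : q ≠ 0 := hq.ne'
    obtain ⟨ζ, hζ, hray⟩ := exists_ray_growth hq0 hr hg hg00 he (he0 hq0) hform
    obtain ⟨B, C', r₁, hB, hr₁, hrr, hup⟩ := exists_norm_le_mul_exp hq0 hr hg he hform
    refine ⟨iff_of_true (not_meromorphicAt_of_ray_growth hq0 hζ hray) (by omega), fun _ => ?_,
      fun h => absurd h (by omega)⟩
    rw [growthOrder_eq_of_kernel_growth hq0 hd hB hr₁ hrr hup hζ hray hw]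
    push_cast
    rfl
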